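/- **Terms.** Fix a countably infinite set of variables. The terms $M$ of the resource control calculus $\lambda_{\circledR}$ and their lists of free variables $Fv[M]$ (sets $Fv(M)$) are defined simultaneously: a variable $x$, with $Fv[x]=[x]$; an abstraction $\lambda x.M$ with $x\in Fv(M)$, where $Fv[\lambda x.M]$ is $Fv[M]$ without $x$; an application $MN$ with $Fv(M)\cap Fv(N)=\emptyset$, where $Fv[MN]$ is the concatenation of $Fv[M]$ and $Fv[N]$; an erasure $x\odot M$ with $x\notin Fv(M)$, where $Fv[x\odot M]$ is $x$ followed by $Fv[M]$; a duplication $x<^{x_1}_{x_2}M$ with $x_1\ne x_2$, $x_1,x_2\in Fv(M)$ and $x\notin Fv(M)\setminus\{x_1,x_2\}$, where $Fv[x<^{x_1}_{x_2}M]$ is $x$ followed by $Fv[M]$ without $x_1,x_2$. Here $\lambda x$ binds $x$ and the duplication binds $x_1,x_2$. Terms are considered up to renaming of bound variables, and bound variables are always taken distinct from the free ones. For lists of variables, $X\odot M$ and $X<^Y_Z M$ denote iterated erasures and duplications. **Substitution.** $M[\![N/x]\!]$ is the normal form of $M[N/x]$, where $[N/x]$ is a formal operator binding $x$ in $M$ (with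 $x\in Fv(M)$ and $(Fv(M)\setminus\{x\})\cap Fv(N)=\emptyset$), evaluated in any context by the rules $x[N/x]\to N$; $(\lambda y.M)[N/x]\to\lambda y.M[N/x]$ ($x\neq y$); $(MP)[N/x]\to M[N/x]\,P$ if $x\in Fv(M)$; $(MP)[N/x]\to M\,P[N/x]$ if $x\in Fv(P)$; $(y\odot M)[N/x]\to y\odot M[N/x]$ ($x\neq y$); $(x\odot M)[N/x]\to Fv[N]\odot M$; $(y<^{y_1}_{y_2}M)[N/x]\to y<^{y_1}_{y_2}M[N/x]$ ($x\ne y$); $(x<^{x_1}_{x_2}M)[N/x]\to Fv[N]<^{Fv[N_1]}_{Fv[N_2]}M[N_1/x_1][N_2/x_2]$, where $N_1,N_2$ are copies of $N$ whose free variables are renamed to distinct fresh variables. **Reduction.** Let $\equiv$ be the least congruence (including renaming of bound variables) with $x\odot(y\odot M)\equiv y\odot(x\odot M)$; $x<^{x_1}_{x_2}M\equiv x<^{x_2}_{x_1}M$; $x<^{y}_{z}(y<^{u}_{v}M)\equiv x<^{y}_{u}(y<^{z}_{v}M)$; $x<^{x_1}_{x_2}(y<^{y_1}_{y_2}M)\equiv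 y<^{y_1}_{y_2}(x<^{x_1}_{x_2}M)$ for $x\ne y_1,y_2$ and $y\neq x_1,x_2$. The reduction $\to$ is the least relation closed under contexts and under $\equiv$ that contains $(\lambda x.M)N\to M[\![N/x]\!]$; $x<^{x_1}_{x_2}(\lambda y.M)\to\lambda y.(x<^{x_1}_{x_2}M)$; $x<^{x_1}_{x_2}(MN)\to(x<^{x_1}_{x_2}M)N$ if $x_1,x_2\notin Fv(N)$; $x<^{x_1}_{x_2}(MN)\to M(x<^{x_1}_{x_2}N)$ if $x_1,x_2\notin Fv(M)$; $\lambda x.(y\odot M)\to y\odot(\lambda x.M)$ if $x\ne y$; $(x\odot M)N\to x\odot(MN)$; $M(x\odot N)\to x\odot(MN)$; $x<^{x_1}_{x_2}(y\odot M)\to y\odot(x<^{x_1}_{x_2}M)$ if $y\neq x_1,x_2$; $x<^{x_1}_{x_2}(x_1\odot M)\to M[\![x/x_2]\!]$. A term is strongly normalising if it belongs to the least set $\mathsf{SN}$ such that $M\in\mathsf{SN}$ whenever every term $N$ with $M\to N$ is in $\mathsf{SN}$ (equivalently, there is no infinite reduction sequence from $M$). **Types.** Strict types are $\sigma::=p\mid\alpha\to\sigma$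 and types are $\alpha::=\bigcap_{i=1}^n\sigma_i$ ($n\ge0$), where $p$ ranges over a countably infinite set of atoms; $\cap$ is associative and commutative, with neutral element $\top$ (the case $n=0$), and is not assumed idempotent. A basis $\Gamma$ is a function from a finite set of variables to types; $\Gamma,\Delta$ is the union of bases with disjoint domains; for bases with the same domain, $(\Gamma\sqcap\Delta)(x)=\Gamma(x)\cap\Delta(x)$; and $\Gamma^\top$ is the basis with the domain of $\Gamma$ and constant value $\top$. The system $\lambda_{\circledR}\cap$ has the rules: $x:\sigma\vdash x:\sigma$; from $\Gamma,x:\alpha\vdash M:\sigma$ infer $\Gamma\vdash\lambda x.M:\alpha\to\sigma$; from $\Gamma\vdash M:(\bigcap_{i=1}^n\tau_i)\to\sigma$ and $\Delta_i\vdash N:\tau_i$ for $i=0,1,\dots,n$ ($n\geq 0$) infer $\Gamma,\ \Delta_0^\top\sqcap\Delta_1\sqcap\dots\sqcap\Delta_n\vdash MN:\sigma$; from $\Gamma,x:\alpha,y:\beta\vdash M:\sigma$ infer $\Gamma,z:\alpha\cap\beta\vdash z<^x_y M:\sigma$; from $\Gamma\vdash M:\sigma$ infer $\Gamma,x:\top\vdash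 x\odot M:\sigma$. **Theorem.** Every strongly normalising $\lambda_{\circledR}$-term $M$ is typeable in $\lambda_{\circledR}\cap$: there are a basis $\Gamma$ and a strict type $\sigma$ with $\Gamma\vdash M:\sigma$. -/

import Mathlib

namespace ResCtrl

/-! ### Preterms

Variables are natural numbers.  `Pre` is the raw syntax of the calculus extended with the
substitution operator; the terms proper are singled out by `IsTerm`, and terms differing in the
names of bound variables are identified by `Alpha`. -/

/-- Raw terms: `var x` is `x`; `lam x M` is `λx.M`; `app M N` is `M N`; `era x M` is the erasure
`x ⊙ M`; `dup x x₁ x₂ M` is the duplication `x <^{x₁}_{x₂} M`, which binds `x₁`, `x₂` in `M` and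
introduces `x`; `sub M x N` is the explicit substitution `M[N/x]`, which binds `x` in `M`. -/
inductive Pre : Type
  | var (x : ℕ) : Pre
  | lam (x : ℕ) (M : Pre) : Pre
  | app (M N : Pre) : Pre
  | era (x : ℕ) (M : Pre) : Pre
  | dup (x x₁ x₂ : ℕ) (M : Pre) : Pre
  | sub (M : Pre) (x : ℕ) (N : Pre) : Pre

namespace Pre

/-- The list `Fv[M]` of free variables; the set `Fv(M)` is given by membership in it. -/
def fv : Pre → List ℕ
  | var x => [x]
  | lam x M => (fv M).filter (fun y => y ≠ x)
  | app M N => fv M ++ fv N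
  | era x M => x :: fv M
  | dup x x₁ x₂ M => x :: (fv M).filter (fun y => y ≠ x₁ ∧ y ≠ x₂)
  | sub M x N => (fv M).filter (fun y => y ≠ x) ++ fv N

/-- Apply a permutation of the variables to all (free and bound) names of a preterm. -/
def perm (π : Equiv.Perm ℕ) : Pre → Pre
  | var x => var (π x)
  | lam x M => lam (π x) (perm π M)
  | app M N => app (perm π M) (perm π N)
  | era x M => era (π x) (perm π M)
  | dup x x₁ x₂ M => dup (π x) (π x₁) (π x₂) (perm π M)
  | sub M x N => sub (perm π M) (π x) (perm π N)

/-- `X ⊙ M = x₁ ⊙ ⋯ ⊙ xₙ ⊙ M` for `X = [x₁, …, xₙ]`. -/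
def eras : List ℕ → Pre → Pre
  | [], M => M
  | x :: X, M => era x (eras X M)

/-- `X <^Y_Z M`, the iterated duplication, for lists `X`, `Y`, `Z` of equal length. -/
def dups : List ℕ → List ℕ → List ℕ → Pre → Pre
  | x :: X, y :: Y, z :: Z, M => dup x y z (dups X Y Z M)
  | _, _, _, M => M

end Pre

open Pre

/-- The set of (well-formed, substitution-free) terms of the resource control calculus. -/
inductive IsTerm : Pre → Prop
  | var (x : ℕ) : IsTerm (var x)
  | lam {x : ℕ} {M : Pre} : IsTerm M → x ∈ fv M → IsTerm (lam x M)
  | app {M N : Pre} : IsTerm M → IsTerm N → (∀ x, x ∈ fv M → x ∉ fv N) → IsTerm (app M N)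
  | era {x : ℕ} {M : Pre} : IsTerm M → x ∉ fv M → IsTerm (era x M)
  | dup {x x₁ x₂ : ℕ} {M : Pre} : IsTerm M → x₁ ∈ fv M → x₂ ∈ fv M → x₁ ≠ x₂ →
      ¬ (x ∈ fv M ∧ x ≠ x₁ ∧ x ≠ x₂) → IsTerm (dup x x₁ x₂ M)

/-- α-equivalence: the least congruence that allows a bound variable to be renamed to a variable
that is not free in the scope of its binder. Interchanging `x` and `y` everywhere in `M` amounts,
up to bound names, to replacing `x` by `y` when `y` is not free in `M`. -/
inductive Alpha : Pre → Pre → Prop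
  | lam_rename {x y : ℕ} {M : Pre} : y ∉ fv M →
      Alpha (lam x M) (lam y (perm (Equiv.swap x y) M))
  | dup_rename_left {x x₁ x₂ y : ℕ} {M : Pre} : x₁ ≠ x₂ → y ≠ x₂ → y ∉ fv M →
      Alpha (dup x x₁ x₂ M) (dup x y x₂ (perm (Equiv.swap x₁ y) M))
  | dup_rename_right {x x₁ x₂ y : ℕ} {M : Pre} : x₁ ≠ x₂ → y ≠ x₁ → y ∉ fv M →
      Alpha (dup x x₁ x₂ M) (dup x x₁ y (perm (Equiv.swap x₂ y) M))
  | sub_rename {x y : ℕ} {M N : Pre} : y ∉ fv M →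
      Alpha (sub M x N) (sub (perm (Equiv.swap x y) M) y N)
  | refl (M : Pre) : Alpha M M
  | symm {M N : Pre} : Alpha M N → Alpha N M
  | trans {M N P : Pre} : Alpha M N → Alpha N P → Alpha M P
  | lam {x : ℕ} {M M' : Pre} : Alpha M M' → Alpha (lam x M) (lam x M')
  | app {M M' N N' : Pre} : Alpha M M' → Alpha N N' → Alpha (app M N) (app M' N')
  | era {x : ℕ} {M M' : Pre} : Alpha M M' → Alpha (era x M) (era x M')
  | dup {x x₁ x₂ : ℕ} {M M' : Pre} : Alpha M M' → Alpha (dup x x₁ x₂ M) (dup x x₁ x₂ M')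
  | sub {x : ℕ} {M M' N N' : Pre} : Alpha M M' → Alpha N N' → Alpha (sub M x N) (sub M' x N')

/-! ### Substitution -/

/-- One-step evaluation of the substitution operator, closed under α-equivalence and contexts.
The side conditions besides those relating `x` to the outermost operator spell out Barendregt's
convention. In the last root rule `perm π₁ N` and `perm π₂ N` are the two copies of `N` whose free
variables have been renamed to distinct fresh ones. -/
inductive SubEval : Pre → Pre → Prop
  | var {x : ℕ} {N : Pre} : SubEval (sub (var x) x N) N
  | lam {x y : ℕ} {M N : Pre} : x ≠ y → y ∉ fv N →
      SubEval (sub (lam y M) x N) (lam y (sub M x N))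
  | app_left {x : ℕ} {M P N : Pre} : x ∈ fv M →
      SubEval (sub (app M P) x N) (app (sub M x N) P)
  | app_right {x : ℕ} {M P N : Pre} : x ∈ fv P →
      SubEval (sub (app M P) x N) (app M (sub P x N))
  | era_ne {x y : ℕ} {M N : Pre} : x ≠ y →
      SubEval (sub (era y M) x N) (era y (sub M x N))
  | era_eq {x : ℕ} {M N : Pre} :
      SubEval (sub (era x M) x N) (eras (fv N) M)
  | dup_ne {x y y₁ y₂ : ℕ} {M N : Pre} : x ≠ y → x ≠ y₁ → x ≠ y₂ → y₁ ∉ fv N → y₂ ∉ fv N →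
      SubEval (sub (dup y y₁ y₂ M) x N) (dup y y₁ y₂ (sub M x N))
  | dup_eq {x x₁ x₂ : ℕ} {M N : Pre} (π₁ π₂ : Equiv.Perm ℕ) :
      (∀ a ∈ fv N, π₁ a ∉ [x, x₁, x₂] ++ fv M ++ fv N) →
      (∀ a ∈ fv N, π₂ a ∉ [x, x₁, x₂] ++ fv M ++ fv N) →
      (∀ a ∈ fv N, ∀ b ∈ fv N, π₁ a ≠ π₂ b) →
      SubEval (sub (dup x x₁ x₂ M) x N)
        (dups (fv N) (fv (perm π₁ N)) (fv (perm π₂ N))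
          (sub (sub M x₁ (perm π₁ N)) x₂ (perm π₂ N)))
  | alpha {M M' N N' : Pre} : Alpha M M' → SubEval M' N' → Alpha N' N → SubEval M N
  | ctx_lam {x : ℕ} {M M' : Pre} : SubEval M M' → SubEval (lam x M) (lam x M')
  | ctx_app_left {M M' N : Pre} : SubEval M M' → SubEval (app M N) (app M' N)
  | ctx_app_right {M N N' : Pre} : SubEval N N' → SubEval (app M N) (app M N')
  | ctx_era {x : ℕ} {M M' : Pre} : SubEval M M' → SubEval (era x M) (era x M')
  | ctx_dup {x x₁ x₂ : ℕ} {M M' : Pre} :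
      SubEval M M' → SubEval (dup x x₁ x₂ M) (dup x x₁ x₂ M')
  | ctx_sub {x : ℕ} {M M' N : Pre} : SubEval M M' → SubEval (sub M x N) (sub M' x N)

/-- `IsSubst M x N P`: `P` is (a representative of) the result of substituting `N` for `x` in `M`,
that is, the normal form of `M[N/x]` with respect to the evaluation of the substitution operator. -/
def IsSubst (M : Pre) (x : ℕ) (N P : Pre) : Prop :=
  Relation.ReflTransGen SubEval (sub M x N) P ∧ ∀ Q, ¬ SubEval P Q

/-! ### Structural equivalence and reduction -/

/-- Structural equivalence: the least congruence that contains α-equivalence and the four axioms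
on erasures and duplications. The names are distinct by Barendregt's convention. -/
inductive StructEq : Pre → Pre → Prop
  | alpha {M N : Pre} : Alpha M N → StructEq M N
  | e1 {x y : ℕ} {M : Pre} : StructEq (era x (era y M)) (era y (era x M))
  | e2 {x x₁ x₂ : ℕ} {M : Pre} : StructEq (dup x x₁ x₂ M) (dup x x₂ x₁ M)
  | e3 {x y z u v : ℕ} {M : Pre} : [x, y, z, u, v].Nodup →
      StructEq (dup x y z (dup y u v M)) (dup x y u (dup y z v M))
  | e4 {x x₁ x₂ y y₁ y₂ : ℕ} {M : Pre} : [x, x₁, x₂, y, y₁, y₂].Nodup →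
      StructEq (dup x x₁ x₂ (dup y y₁ y₂ M)) (dup y y₁ y₂ (dup x x₁ x₂ M))
  | refl (M : Pre) : StructEq M M
  | symm {M N : Pre} : StructEq M N → StructEq N M
  | trans {M N P : Pre} : StructEq M N → StructEq N P → StructEq M P
  | lam {x : ℕ} {M M' : Pre} : StructEq M M' → StructEq (lam x M) (lam x M')
  | app {M M' N N' : Pre} : StructEq M M' → StructEq N N' → StructEq (app M N) (app M' N')
  | era {x : ℕ} {M M' : Pre} : StructEq M M' → StructEq (era x M) (era x M')
  | dup {x x₁ x₂ : ℕ} {M M' : Pre} :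
      StructEq M M' → StructEq (dup x x₁ x₂ M) (dup x x₁ x₂ M')

/-- The reduction relation `→`, closed under structural equivalence and contexts. -/
inductive Step : Pre → Pre → Prop
  | beta {x : ℕ} {M N P : Pre} : IsSubst M x N P → Step (app (lam x M) N) P
  | gamma1 {x x₁ x₂ y : ℕ} {M : Pre} : y ≠ x → y ≠ x₁ → y ≠ x₂ →
      Step (dup x x₁ x₂ (lam y M)) (lam y (dup x x₁ x₂ M))
  | gamma2 {x x₁ x₂ : ℕ} {M N : Pre} : x₁ ∉ fv N → x₂ ∉ fv N →
      Step (dup x x₁ x₂ (app M N)) (app (dup x x₁ x₂ M) N)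
  | gamma3 {x x₁ x₂ : ℕ} {M N : Pre} : x₁ ∉ fv M → x₂ ∉ fv M →
      Step (dup x x₁ x₂ (app M N)) (app M (dup x x₁ x₂ N))
  | omega1 {x y : ℕ} {M : Pre} : x ≠ y → Step (lam x (era y M)) (era y (lam x M))
  | omega2 {x : ℕ} {M N : Pre} : Step (app (era x M) N) (era x (app M N))
  | omega3 {x : ℕ} {M N : Pre} : Step (app M (era x N)) (era x (app M N))
  | gammaOmega1 {x x₁ x₂ y : ℕ} {M : Pre} : y ≠ x₁ → y ≠ x₂ →
      Step (dup x x₁ x₂ (era y M)) (era y (dup x x₁ x₂ M))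
  | gammaOmega2 {x x₁ x₂ : ℕ} {M P : Pre} : IsSubst M x₂ (var x) P →
      Step (dup x x₁ x₂ (era x₁ M)) P
  | equiv {M M' N N' : Pre} : StructEq M M' → Step M' N' → StructEq N' N → Step M N
  | ctx_lam {x : ℕ} {M M' : Pre} : Step M M' → Step (lam x M) (lam x M')
  | ctx_app_left {M M' N : Pre} : Step M M' → Step (app M N) (app M' N)
  | ctx_app_right {M N N' : Pre} : Step N N' → Step (app M N) (app M N')
  | ctx_era {x : ℕ} {M M' : Pre} : Step M M' → Step (era x M) (era x M')
  | ctx_dup {x x₁ x₂ : ℕ} {M M' : Pre} : Step M M' → Step (dup x x₁ x₂ M) (dup x x₁ x₂ M')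

/-- Strong normalisation: the least set containing every term all of whose reducts belong to it
(in particular every normal form). -/
inductive SN : Pre → Prop
  | intro {M : Pre} : (∀ N, IsTerm N → Step M N → SN N) → SN M

/-! ### Types -/

/-- Raw strict types `p` and `σ₁ ∩ ⋯ ∩ σₙ → σ`; an intersection is written as a list, the empty
list being `⊤`, so that associativity of `∩` and neutrality of `⊤` are built in. -/
inductive PreStrict : Type
  | atom (p : ℕ) : PreStrict
  | arrow (A : List PreStrict) (σ : PreStrict) : PreStrict

/-- The least congruence that makes intersection commutative. -/
inductive PreStrict.Eqv : PreStrict → PreStrict → Prop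
  | perm {A B : List PreStrict} {σ : PreStrict} : A.Perm B → Eqv (arrow A σ) (arrow B σ)
  | dom {A B : List PreStrict} {σ τ ρ : PreStrict} : Eqv σ τ →
      Eqv (arrow (A ++ σ :: B) ρ) (arrow (A ++ τ :: B) ρ)
  | cod {A : List PreStrict} {σ τ : PreStrict} : Eqv σ τ → Eqv (arrow A σ) (arrow A τ)
  | refl (σ : PreStrict) : Eqv σ σ
  | symm {σ τ : PreStrict} : Eqv σ τ → Eqv τ σ
  | trans {σ τ ρ : PreStrict} : Eqv σ τ → Eqv τ ρ → Eqv σ ρ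

instance PreStrict.setoid : Setoid PreStrict :=
  ⟨PreStrict.Eqv, ⟨PreStrict.Eqv.refl, PreStrict.Eqv.symm, PreStrict.Eqv.trans⟩⟩

/-- Strict types, modulo commutativity (and associativity) of intersection. -/
def Strict : Type := Quotient PreStrict.setoid

/-- Types: finite intersections `⋂ᵢⁿ σᵢ` of strict types. As `∩` is commutative and associative
with neutral element `⊤`, and not assumed idempotent, they are multisets: `∩` is `+`, `⊤` is `0`
and a strict type `σ` is `{σ}`. -/
abbrev Ty : Type := Multiset Strict

/-- The strict type represented by a raw one. -/
def Strict.mk (s : PreStrict) : Strict := Quotient.mk PreStrict.setoid s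

/-- A representative of a strict type. -/
noncomputable def Strict.rep (σ : Strict) : PreStrict := Quotient.out (s := PreStrict.setoid) σ

theorem Strict.mk_eq {s t : PreStrict} : Strict.mk s = Strict.mk t ↔ PreStrict.Eqv s t :=
  ⟨fun h => Quotient.exact h, fun h => Quotient.sound h⟩

@[simp] theorem Strict.mk_rep (σ : Strict) : Strict.mk σ.rep = σ := Quotient.out_eq σ

@[simp] theorem Strict.map_mk_rep (l : List Strict) : (l.map Strict.rep).map Strict.mk = l := by
  induction l with
  | nil => rfl
  | cons a l ih => rw [List.map_cons, List.map_cons, ih, Strict.mk_rep]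

/-- A type atom, as a strict type. -/
def Strict.atom (p : ℕ) : Strict := Strict.mk (PreStrict.atom p)

/-- The strict type `A → σ`, formed on representatives; see `Strict.arrow_mk`. -/
noncomputable def Strict.arrow (A : Ty) (σ : Strict) : Strict :=
  Strict.mk (PreStrict.arrow (A.toList.map Strict.rep) σ.rep)

theorem PreStrict.Eqv.arrow_congr {A B : List PreStrict} {σ τ : PreStrict}
    (h : List.Forall₂ PreStrict.Eqv A B) (hσ : PreStrict.Eqv σ τ) :
    PreStrict.Eqv (.arrow A σ) (.arrow B τ) := by
  have key : ∀ C : List PreStrict,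
      PreStrict.Eqv (.arrow (C ++ A) σ) (.arrow (C ++ B) σ) := by
    induction h with
    | nil => intro C; exact .refl _
    | @cons a b l l' hab _ ih =>
      intro C
      refine .trans (.dom hab) ?_
      have := ih (C ++ [b])
      simpa using this
  exact .trans (by simpa using key []) (.cod hσ)

/-- The arrow of strict types does not depend on the chosen representatives. -/
theorem Strict.arrow_mk (A : List PreStrict) (σ : PreStrict) :
    Strict.arrow (Multiset.ofList (A.map Strict.mk)) (Strict.mk σ) =
      Strict.mk (.arrow A σ) := by
  apply Strict.mk_eq.2
  have hr : ∀ s, PreStrict.Eqv (Strict.mk s).rep s := fun s =>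
    Strict.mk_eq.1 (Strict.mk_rep _)
  have hp : ((Multiset.ofList (A.map Strict.mk)).toList).Perm (A.map Strict.mk) := by
    rw [← Multiset.coe_eq_coe, Multiset.coe_toList]
  refine PreStrict.Eqv.trans (PreStrict.Eqv.perm (hp.map Strict.rep)) ?_
  refine PreStrict.Eqv.arrow_congr ?_ (hr σ)
  rw [List.map_map, List.forall₂_map_left_iff, List.forall₂_same]
  exact fun s _ => hr s

/-- Arrow types are equal only if their components are. -/
theorem Strict.arrow_inj {A B : Ty} {σ τ : Strict} :
    Strict.arrow A σ = Strict.arrow B τ ↔ A = B ∧ σ = τ := by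
  refine ⟨fun h => ?_, by rintro ⟨rfl, rfl⟩; rfl⟩
  let f : PreStrict → Option (Ty × Strict)
    | .atom _ => none
    | .arrow A σ => some (Multiset.ofList (A.map Strict.mk), Strict.mk σ)
  have hf : ∀ s t, PreStrict.Eqv s t → f s = f t := by
    intro s t hst
    induction hst with
    | perm hp => simp only [f]; rw [Multiset.coe_eq_coe.2 (hp.map Strict.mk)]
    | dom hs _ => simp [f, Strict.mk_eq.2 hs]
    | cod hs _ => simp [f, Strict.mk_eq.2 hs]
    | refl => rfl
    | symm _ ih => exact ih.symm
    | trans _ _ ih ih' => exact ih.trans ih'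
  have := hf _ _ (Strict.mk_eq.1 h)
  simpa only [f, Strict.map_mk_rep, Strict.mk_rep, Multiset.coe_toList, Option.some.injEq,
    Prod.mk.injEq] using this

/-! ### Type assignment -/

/-- A basis is a partial function from variables to types. Its domain is finite whenever it occurs
in a derivable judgement, where it is the set of free variables; see `Typing.isSome_iff`. -/
abbrev TBasis : Type := ℕ → Option Ty

namespace TBasis

/-- The basis `x : A`. -/
def single (x : ℕ) (A : Ty) : TBasis := fun y => if y = x then some A else none

/-- The basis `Γ, Δ`, for bases with disjoint domains. -/
def join (Γ Δ : TBasis) : TBasis := fun y => (Γ y).or (Δ y)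

/-- `Γ` and `Δ` have disjoint domains. -/
def Disj (Γ Δ : TBasis) : Prop := ∀ y, Γ y = none ∨ Δ y = none

/-- `Γ` and `Δ` have the same domain. -/
def SameDom (Γ Δ : TBasis) : Prop := ∀ y, Γ y = none ↔ Δ y = none

/-- The bases intersection `Γ ⊓ Δ`, for bases with the same domain. -/
def inter (Γ Δ : TBasis) : TBasis := fun y => Option.map₂ (fun A B => A + B) (Γ y) (Δ y)

/-- The basis `Γ^⊤`, with the domain of `Γ` and constant value `⊤`. -/
def top (Γ : TBasis) : TBasis := fun y => (Γ y).map (fun _ => 0)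

/-- `Δ₀^⊤ ⊓ Δ₁ ⊓ ⋯ ⊓ Δₙ`. -/
def interTop (Δ₀ : TBasis) (Δ : List TBasis) : TBasis := Δ.foldl inter (top Δ₀)

end TBasis

open TBasis

/-- `Typing Γ M σ` is the judgement `Γ ⊢ M : σ` of the intersection type assignment system. In the
rule `arrE`, the list `D` consists of the pairs `(Δ₁, τ₁), …, (Δₙ, τₙ)` with `n ≥ 0`. -/
inductive Typing : TBasis → Pre → Strict → Prop
  | ax (x : ℕ) (σ : Strict) : Typing (single x {σ}) (var x) σ
  | arrI {Γ : TBasis} {x : ℕ} {A : Ty} {M : Pre} {σ : Strict} : Γ x = none →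
      Typing (join Γ (single x A)) M σ → Typing Γ (lam x M) (Strict.arrow A σ)
  | arrE {Γ Δ₀ : TBasis} {M N : Pre} {σ τ₀ : Strict} (D : List (TBasis × Strict)) :
      Typing Γ M (Strict.arrow (Multiset.ofList (D.map Prod.snd)) σ) →
      Typing Δ₀ N τ₀ →
      (∀ d ∈ D, Typing d.1 N d.2) →
      (∀ d ∈ D, SameDom Δ₀ d.1) →
      Disj Γ Δ₀ →
      Typing (join Γ (interTop Δ₀ (D.map Prod.fst))) (app M N) σ
  | cont {Γ : TBasis} {x y z : ℕ} {A B : Ty} {M : Pre} {σ : Strict} :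
      Γ x = none → Γ y = none → Γ z = none → x ≠ y →
      Typing (join (join Γ (single x A)) (single y B)) M σ →
      Typing (join Γ (single z (A + B))) (dup z x y M) σ
  | thin {Γ : TBasis} {x : ℕ} {M : Pre} {σ : Strict} : Γ x = none →
      Typing Γ M σ → Typing (join Γ (single x 0)) (era x M) σ

theorem TBasis.interTop_isSome {Δ₀ : TBasis} {L : List TBasis} (h : ∀ Δ ∈ L, SameDom Δ₀ Δ) (v : ℕ) :
    (interTop Δ₀ L v).isSome ↔ (Δ₀ v).isSome := by
  suffices H : ∀ (L : List TBasis) (Θ : TBasis), (∀ Δ ∈ L, SameDom Δ₀ Δ) → SameDom Δ₀ Θ →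
      SameDom Δ₀ (L.foldl inter Θ) by
    have := H L (top Δ₀) h (fun y => by simp [top]) v
    simp only [interTop, Option.isSome_iff_ne_none, ne_eq, this]
  intro L
  induction L with
  | nil => intro Θ _ hΘ; exact hΘ
  | cons a l ih =>
    intro Θ hL hΘ
    refine ih _ (fun Δ hΔ => hL Δ (by simp [hΔ])) (fun y => ?_)
    have h1 := hL a (by simp) y
    have h2 := hΘ y
    rw [inter, Option.map₂_eq_none_iff, ← h1, ← h2, or_self]

/-- The domain of a basis in a derivable judgement is the set of free variables of the term. -/
theorem Typing.isSome_iff {Γ : TBasis} {M : Pre} {σ : Strict} (h : Typing Γ M σ) (v : ℕ) :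
    (Γ v).isSome ↔ v ∈ fv M := by
  induction h with
  | ax x σ => by_cases hv : v = x <;> simp [single, fv, hv]
  | @arrI Γ x A M σ hx _ ih =>
    by_cases hv : v = x
    · subst hv; simp [hx, fv]
    · simpa [join, single, fv, hv] using ih
  | @arrE Γ Δ₀ M N σ τ₀ D _ _ _ hD _ ihM ihN _ =>
    have : (interTop Δ₀ (D.map Prod.fst) v).isSome ↔ (Δ₀ v).isSome :=
      interTop_isSome (by simpa using fun Δ τ hΔ => hD (Δ, τ) hΔ) v
    simp [join, fv, ihM, this, ihN]
  | @cont Γ x y z A B M σ hx hy hz hxy _ ih =>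
    by_cases hv : v = z
    · subst hv; simp [join, single, fv]
    by_cases h1 : v = x
    · subst h1; simp [join, single, fv, hv, hx]
    by_cases h2 : v = y
    · subst h2; simp [join, single, fv, hv, hy]
    · simpa [join, single, fv, hv, h1, h2] using ih
  | @thin Γ x M σ hx _ ih =>
    by_cases hv : v = x
    · subst hv; simp [join, single, fv]
    · simpa [join, single, fv, hv] using ih

/-- A term is typeable if it has some strict type in some basis. -/
def Typeable (M : Pre) : Prop := ∃ (Γ : TBasis) (σ : Strict), Typing Γ M σ

end ResCtrl

/-! The proof passes through the pure lambda calculus. Erasing the resource operators turns a term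
into a plain lambda term (`interp`): erasures disappear, and the two names bound by a duplication
both receive the value of the duplicated variable. Three facts then give the theorem.

(1) Strong normalisation is inherited by the plain term (`SN.acc_interp`). Each β-step of the plain
term is simulated by at least one step of the resource term (`IsTerm.exists_lift_beta`), so the
plain term cannot reduce forever. The only obstacle is that the abstraction of a plain redex may be
hidden in the resource term under duplications and erasures. Silent steps, which leave the plain
term unchanged, push duplications into the abstraction and move erasures outwards until the redex is
exposed. Contracting it requires that substitution is defined on terms and is interpreted by
ordinary substitution (`IsTerm.exists_isSubst`). All steps used preserve the set of free variables,
so they can be performed inside any term.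

(2) A strongly normalising plain term is typeable with non-idempotent intersections
(`LTypeable.of_acc`). This is subject expansion along head reduction: a derivation for a contractum
is cut at the copies of the argument (`LTyping.anti_subst`), and the pieces become the premises for
the argument of the redex. An erased argument leaves no pieces. The application rule therefore asks
for one further typing of the argument, which is available because the argument is a proper subterm
and is handled by induction.

(3) A derivation for the plain term can be read back as a derivation for the resource term
(`IsTerm.typing_of_interp`). Plain contexts are total functions into multisets of strict types, so
two copies of a variable simply add their types, as in the duplication rule. What such a context
forgets, namely the domain of the basis, is recovered from the free variables: they are exactly the
variables in the domain, and an erased variable has type `⊤`. -/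

namespace ResCtrl

/-! ### Plain lambda terms -/

/-- Terms of the pure lambda calculus, with de Bruijn indices. -/
inductive Lam : Type
  | var (n : ℕ) : Lam
  | lam (t : Lam) : Lam
  | app (t u : Lam) : Lam

namespace Lam

/-- The renaming `ξ` moved under a binder. -/
def upr (ξ : ℕ → ℕ) : ℕ → ℕ
  | 0 => 0
  | n + 1 => ξ n + 1

/-- Renaming of the free variables. -/
def ren (ξ : ℕ → ℕ) : Lam → Lam
  | var n => var (ξ n)
  | lam t => lam (ren (upr ξ) t)
  | app t u => app (ren ξ t) (ren ξ u)

/-- Weakening. -/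
abbrev shift (t : Lam) : Lam := ren Nat.succ t

/-- The substitution `s` moved under a binder. -/
def ups (s : ℕ → Lam) : ℕ → Lam
  | 0 => var 0
  | n + 1 => shift (s n)

/-- Parallel substitution. -/
def subst (s : ℕ → Lam) : Lam → Lam
  | var n => s n
  | lam t => lam (subst (ups s) t)
  | app t u => app (subst s t) (subst s u)

/-- The substitution that replaces the variable `0` by `u` and lowers the others. -/
def inst (u : Lam) : ℕ → Lam
  | 0 => u
  | n + 1 => var n

/-! ### Algebra of renaming and parallel substitution -/

theorem ren_ren (ξ ζ : ℕ → ℕ) (t : Lam) : ren ζ (ren ξ t) = ren (ζ ∘ ξ) t := by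
  induction t generalizing ξ ζ with
  | var n => rfl
  | lam t ih =>
    simp only [ren, ih]
    congr 2; ext n; cases n <;> rfl
  | app t u iht ihu => simp only [ren, iht, ihu]

theorem ren_upr_shift (ξ : ℕ → ℕ) (t : Lam) : ren (upr ξ) (shift t) = shift (ren ξ t) := by
  simp only [shift, ren_ren]; rfl

theorem subst_ren (ξ : ℕ → ℕ) (s : ℕ → Lam) (t : Lam) : subst s (ren ξ t) = subst (s ∘ ξ) t := by
  induction t generalizing ξ s with
  | var n => rfl
  | lam t ih =>
    simp only [ren, subst, ih]
    congr 2; ext n; cases n <;> rfl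
  | app t u iht ihu => simp only [ren, subst, iht, ihu]

theorem ren_subst (ξ : ℕ → ℕ) (s : ℕ → Lam) (t : Lam) :
    ren ξ (subst s t) = subst (fun n => ren ξ (s n)) t := by
  induction t generalizing ξ s with
  | var n => rfl
  | lam t ih =>
    simp only [ren, subst, ih]
    congr 2; ext n
    cases n with
    | zero => rfl
    | succ n => exact ren_upr_shift ξ (s n)
  | app t u iht ihu => simp only [ren, subst, iht, ihu]

theorem subst_ups_shift (s : ℕ → Lam) (t : Lam) : subst (ups s) (shift t) = shift (subst s t) := by
  simp only [shift, subst_ren, ren_subst]; rfl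

theorem subst_var (t : Lam) : subst var t = t := by
  induction t with
  | var n => rfl
  | lam t ih =>
    have : ups var = var := by ext n; cases n <;> rfl
    simp only [subst, this, ih]
  | app t u iht ihu => simp only [subst, iht, ihu]

theorem subst_inst_shift (u t : Lam) : subst (inst u) (shift t) = t := by
  rw [shift, subst_ren]; exact subst_var t

/-- β-reduction. -/
inductive Beta : Lam → Lam → Prop
  | beta (t u : Lam) : Beta (app (lam t) u) (subst (inst u) t)
  | lam {t t' : Lam} : Beta t t' → Beta (lam t) (lam t')
  | app_left {t t' u : Lam} : Beta t t' → Beta (app t u) (app t' u)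
  | app_right {t u u' : Lam} : Beta u u' → Beta (app t u) (app t u')

/-- Head reduction of applications. -/
inductive HeadRed : Lam → Lam → Prop
  | beta (t u : Lam) : HeadRed (app (lam t) u) (subst (inst u) t)
  | app {t t' u : Lam} : HeadRed t t' → HeadRed (app t u) (app t' u)

theorem HeadRed.toBeta {t t' : Lam} (h : HeadRed t t') : Beta t t' := by
  induction h with
  | beta t u => exact .beta t u
  | app _ ih => exact .app_left ih

/-- A variable applied to arguments. -/
inductive Neutral : Lam → Prop
  | var (n : ℕ) : Neutral (var n)
  | app {t u : Lam} : Neutral t → Neutral (app t u)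

theorem head_cases (t : Lam) : (∃ b, t = lam b) ∨ Neutral t ∨ ∃ t', HeadRed t t' := by
  induction t with
  | var n => exact .inr (.inl (.var n))
  | lam t _ => exact .inl ⟨t, rfl⟩
  | app t u ih _ =>
    obtain ⟨b, rfl⟩ | h | ⟨t', h⟩ := ih
    · exact .inr (.inr ⟨_, .beta b u⟩)
    · exact .inr (.inl (.app h))
    · exact .inr (.inr ⟨_, .app h⟩)

/-- `SubT s t`: `s` is a subterm of `t`. -/
inductive SubT : Lam → Lam → Prop
  | refl (t : Lam) : SubT t t
  | lam {s t : Lam} : SubT s t → SubT s (lam t)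
  | app_left {s t u : Lam} : SubT s t → SubT s (app t u)
  | app_right {s t u : Lam} : SubT s u → SubT s (app t u)

theorem SubT.trans {r s t : Lam} (h₁ : SubT r s) (h₂ : SubT s t) : SubT r t := by
  induction h₂ with
  | refl => exact h₁
  | lam _ ih => exact .lam ih
  | app_left _ ih => exact .app_left ih
  | app_right _ ih => exact .app_right ih

/-- Allows an induction on the reductions of an ambient term to follow one of its subterms. -/
theorem SubT.lift_beta {s s' t : Lam} (h : SubT s t) (hs : Beta s s') :
    ∃ t', Beta t t' ∧ SubT s' t' := by
  induction h with
  | refl => exact ⟨s', hs, .refl _⟩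
  | lam _ ih => obtain ⟨t', h, h'⟩ := ih; exact ⟨_, .lam h, .lam h'⟩
  | app_left _ ih => obtain ⟨t', h, h'⟩ := ih; exact ⟨_, .app_left h, .app_left h'⟩
  | app_right _ ih => obtain ⟨t', h, h'⟩ := ih; exact ⟨_, .app_right h, .app_right h'⟩

theorem SubT.eq_or_lt {s t : Lam} (h : SubT s t) : s = t ∨ sizeOf s < sizeOf t := by
  induction h with
  | refl => exact .inl rfl
  | lam _ ih => rcases ih with rfl | ih <;> right <;> simp; omega
  | app_left _ ih => rcases ih with rfl | ih <;> right <;> simp <;> omega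
  | app_right _ ih => rcases ih with rfl | ih <;> right <;> simp; omega

theorem SubT.le {s t : Lam} (h : SubT s t) : sizeOf s ≤ sizeOf t := by
  rcases h.eq_or_lt with rfl | h
  exacts [le_rfl, h.le]

end Lam

/-! ### Intersection types for plain lambda terms -/

open Lam

/-- A total context, with value `⊤` on irrelevant variables. -/
abbrev Ctx : Type := ℕ → Ty

/-- The context without its variable `0`. -/
def Ctx.tail (Γ : Ctx) : Ctx := fun n => Γ (n + 1)

@[simp] theorem Ctx.tail_zero : Ctx.tail 0 = 0 := rfl

@[simp] theorem Ctx.tail_add (Γ Δ : Ctx) : Ctx.tail (Γ + Δ) = Ctx.tail Γ + Ctx.tail Δ := rfl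

@[simp] theorem Ctx.tail_single_zero (A : Ty) : Ctx.tail (Pi.single 0 A) = 0 := by
  ext1 n; simp [Ctx.tail]

@[simp] theorem Ctx.tail_single_succ (n : ℕ) (A : Ty) :
    Ctx.tail (Pi.single (n + 1) A) = Pi.single n A := by
  ext1 m; simp [Ctx.tail, Pi.single_apply]

/-- Non-idempotent intersection type assignment for plain lambda terms, in which every argument
has to be typeable. -/
inductive LTyping : Ctx → Lam → Strict → Prop
  | var (n : ℕ) (σ : Strict) : LTyping (Pi.single n {σ}) (.var n) σ
  | lam {Γ : Ctx} {t : Lam} {σ : Strict} : LTyping Γ t σ →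
      LTyping (Ctx.tail Γ) (.lam t) (Strict.arrow (Γ 0) σ)
  | app {Γ Δ₀ : Ctx} {t u : Lam} {σ τ₀ : Strict} (D : List (Ctx × Strict)) :
      LTyping Γ t (Strict.arrow (Multiset.ofList (D.map Prod.snd)) σ) →
      LTyping Δ₀ u τ₀ →
      (∀ d ∈ D, LTyping d.1 u d.2) →
      LTyping (Γ + (D.map Prod.fst).sum) (.app t u) σ

theorem LTyping.var_inv {Γ : Ctx} {n : ℕ} {σ : Strict} (h : LTyping Γ (.var n) σ) :
    Γ = Pi.single n {σ} := by
  cases h; rfl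

/-- `SRel s Γ Δ`: the context `Δ` is a sum of contexts in which the terms `s x` have the types
that `Γ` assigns to the variables `x`. -/
inductive SRel (s : ℕ → Lam) : Ctx → Ctx → Prop
  | zero : SRel s 0 0
  | single {x : ℕ} {σ : Strict} {Δ : Ctx} : LTyping Δ (s x) σ → SRel s (Pi.single x {σ}) Δ
  | add {Γ Γ' Δ Δ' : Ctx} : SRel s Γ Δ → SRel s Γ' Δ' → SRel s (Γ + Γ') (Δ + Δ')

theorem SRel.list_sum {ι : Type*} {s : ℕ → Lam} (D : List ι) (f g : ι → Ctx)
    (h : ∀ d ∈ D, SRel s (f d) (g d)) : SRel s (D.map f).sum (D.map g).sum := by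
  induction D with
  | nil => exact .zero
  | cons d D ih =>
    simp only [List.map_cons, List.sum_cons]
    exact .add (h d (by simp)) (ih fun d hd => h d (by simp [hd]))

/-- The variables of a renaming, as a substitution. -/
abbrev varsOf (ξ : ℕ → ℕ) : ℕ → Lam := fun n => .var (ξ n)

/-- The application case common to renamings and substitutions. The typings of the argument listed
in `D` are pulled back one by one and their contexts add up. The extra typing only has to survive,
so its context is dropped. -/
theorem LTyping.app_anti {Γ : Ctx} {s : ℕ → Lam} {t u t' u' : Lam} {σ : Strict}
    (h : LTyping Γ (.app t' u') σ)
    (ht : ∀ {Γ τ}, LTyping Γ t' τ → ∃ Γ', LTyping Γ' t τ ∧ SRel s Γ' Γ)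
    (hu : ∀ {Γ τ}, LTyping Γ u' τ → ∃ Γ', LTyping Γ' u τ ∧ SRel s Γ' Γ) :
    ∃ Γ', LTyping Γ' (.app t u) σ ∧ SRel s Γ' Γ := by
  cases h with
  | @app Γ Δ₀ _ _ _ τ₀ D h₁ h₂ h₃ =>
    obtain ⟨Γ', h₁', hr⟩ := ht h₁
    obtain ⟨Δ₀', h₂', -⟩ := hu h₂
    have h₄ : ∀ d : Ctx × Strict, ∃ Δ, d ∈ D → LTyping Δ u d.2 ∧ SRel s Δ d.1 := fun d => by
      by_cases hd : d ∈ D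
      · obtain ⟨Δ, h⟩ := hu (h₃ d hd); exact ⟨Δ, fun _ => h⟩
      · exact ⟨0, fun h => absurd h hd⟩
    choose f hf using h₄
    refine ⟨Γ' + (D.map f).sum, ?_, .add hr (SRel.list_sum D f Prod.fst fun d hd => (hf d hd).2)⟩
    have := LTyping.app (Γ := Γ') (Δ₀ := Δ₀') (t := t) (u := u) (σ := σ) (τ₀ := τ₀)
      (D.map fun d => (f d, d.2)) (by simpa [Function.comp_def] using h₁') h₂'
      (by
        intro d hd
        obtain ⟨e, he, rfl⟩ := List.mem_map.1 hd
        exact (hf e he).1)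
    simpa [Function.comp_def] using this

theorem SRel.of_upr {ξ : ℕ → ℕ} {Γ Δ : Ctx} (h : SRel (varsOf (upr ξ)) Γ Δ) :
    Γ 0 = Δ 0 ∧ SRel (varsOf ξ) Γ.tail Δ.tail := by
  induction h with
  | zero => exact ⟨rfl, .zero⟩
  | @single x σ Δ h =>
    rw [h.var_inv]
    cases x with
    | zero => simpa [upr] using SRel.zero
    | succ x => simpa [upr] using SRel.single (s := varsOf ξ) (.var (ξ x) σ)
  | add _ _ ih ih' => exact ⟨by simp [ih.1, ih'.1], .add ih.2 ih'.2⟩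

/-- Treated before general substitutions because crossing a binder there requires undoing a shift.
-/
theorem LTyping.anti_ren {Γ : Ctx} {ξ : ℕ → ℕ} {t : Lam} {σ : Strict}
    (h : LTyping Γ (ren ξ t) σ) : ∃ Γ', LTyping Γ' t σ ∧ SRel (varsOf ξ) Γ' Γ := by
  induction t generalizing Γ ξ σ with
  | var n => exact ⟨_, .var n σ, .single h⟩
  | lam t ih =>
    cases h with
    | lam h =>
      obtain ⟨Γ', h₁, h₂⟩ := ih h
      rw [← h₂.of_upr.1]
      exact ⟨_, .lam h₁, h₂.of_upr.2⟩
  | app t u iht ihu => exact h.app_anti iht ihu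

/-- The system is relevant: only variables that occur receive a type other than `⊤`, and a shifted
term does not mention the variable `0`. -/
theorem LTyping.of_shift {Γ : Ctx} {t : Lam} {σ : Strict} (h : LTyping Γ (shift t) σ) :
    Γ 0 = 0 ∧ LTyping Γ.tail t σ := by
  obtain ⟨Γ', h₁, h₂⟩ := h.anti_ren
  have : Γ 0 = 0 ∧ Γ' = Γ.tail := by
    clear h h₁
    induction h₂ with
    | zero => exact ⟨rfl, rfl⟩
    | single h => rw [h.var_inv]; simp
    | add _ _ ih ih' => simp [ih.1, ih'.1, ih.2, ih'.2]
  exact ⟨this.1, this.2 ▸ h₁⟩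

/-- Binding the variable `x` of an environment by an abstraction. -/
theorem SRel.of_binder {s s' : ℕ → Lam} {x : ℕ} {f : ℕ → ℕ} (hx : s' x = .var 0)
    (hs : ∀ y, y ≠ x → s' y = shift (s (f y))) (F : Ctx → Ctx)
    (hF₀ : F 0 = 0) (hFa : ∀ A B, F (A + B) = F A + F B)
    (hFx : ∀ A, F (Pi.single x A) = 0) (hF : ∀ y A, y ≠ x → F (Pi.single y A) = Pi.single (f y) A)
    {Γ Δ : Ctx} (h : SRel s' Γ Δ) : Γ x = Δ 0 ∧ SRel s (F Γ) Δ.tail := by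
  induction h with
  | zero => exact ⟨rfl, by rw [hF₀]; exact SRel.zero⟩
  | @single y σ Δ h =>
    by_cases hy : y = x
    · subst hy
      rw [hx] at h
      rw [h.var_inv]
      simpa [hFx] using SRel.zero
    · rw [hs y hy] at h
      obtain ⟨h₁, h₂⟩ := h.of_shift
      rw [hF y _ hy, h₁, Pi.single_eq_of_ne' hy]
      exact ⟨rfl, .single h₂⟩
  | add _ _ ih ih' =>
    rw [hFa]
    exact ⟨by simp [ih.1, ih'.1], .add ih.2 ih'.2⟩

theorem SRel.of_ups {s : ℕ → Lam} {Γ Δ : Ctx} (h : SRel (ups s) Γ Δ) :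
    Γ 0 = Δ 0 ∧ SRel s Γ.tail Δ.tail := by
  refine SRel.of_binder (s := s) (x := 0) (s' := ups s) (f := Nat.pred) rfl ?_
    Ctx.tail rfl (fun _ _ => rfl) (by simp) ?_ h
  · intro y hy; cases y with
    | zero => exact absurd rfl hy
    | succ y => rfl
  · intro y A hy; cases y with
    | zero => exact absurd rfl hy
    | succ y => simp

/-- The subderivations that type copies of the `s n` are cut off and replaced by axioms. As
intersection is not idempotent, each copy is counted once and the contexts that are cut off add up
to the given one. -/
theorem LTyping.anti_subst {Γ : Ctx} {s : ℕ → Lam} {t : Lam} {σ : Strict}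
    (h : LTyping Γ (subst s t) σ) : ∃ Γ', LTyping Γ' t σ ∧ SRel s Γ' Γ := by
  induction t generalizing Γ s σ with
  | var n => exact ⟨_, .var n σ, .single h⟩
  | lam t ih =>
    cases h with
    | lam h =>
      obtain ⟨Γ', h₁, h₂⟩ := ih h
      rw [← h₂.of_ups.1]
      exact ⟨_, .lam h₁, h₂.of_ups.2⟩
  | app t u iht ihu => exact h.app_anti iht ihu

/-- The types requested at `0` become the list of premises for the argument of a redex. Requests at
`n + 1` are met by axioms and reproduce the remaining context. -/
theorem SRel.of_inst {u : Lam} {Γ Δ : Ctx} (h : SRel (inst u) Γ Δ) :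
    ∃ D : List (Ctx × Strict), (∀ d ∈ D, LTyping d.1 u d.2) ∧
      Γ 0 = Multiset.ofList (D.map Prod.snd) ∧ Δ = Γ.tail + (D.map Prod.fst).sum := by
  induction h with
  | zero => exact ⟨[], by simp⟩
  | @single x σ Δ h =>
    cases x with
    | zero => exact ⟨[(Δ, σ)], by simpa [inst] using h⟩
    | succ x => exact ⟨[], by simp, by simp, by simp [LTyping.var_inv h]⟩
  | add _ _ ih ih' =>
    obtain ⟨D, h₁, h₂, h₃⟩ := ih
    obtain ⟨D', h₁', h₂', h₃'⟩ := ih'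
    refine ⟨D ++ D', ?_, ?_, ?_⟩
    · intro d hd
      rcases List.mem_append.1 hd with h | h
      exacts [h₁ d h, h₁' d h]
    · simp [h₂, h₂']
    · rw [h₃, h₃', List.map_append, List.sum_append, Ctx.tail_add]; abel

/-- A plain lambda term is typeable. -/
def LTypeable (t : Lam) : Prop := ∃ Γ σ, LTyping Γ t σ

/-- Head position lets the induction keep the same type and context. The argument of the contracted
redex is a proper subterm, so the hypothesis on subterms types it even when it is erased. -/
theorem LTyping.head_expand {t t' : Lam} (h : HeadRed t t')
    (hs : ∀ r, SubT r t → r ≠ t → LTypeable r) {Γ : Ctx} {σ : Strict} (ht : LTyping Γ t' σ) :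
    LTyping Γ t σ := by
  induction h generalizing Γ σ with
  | beta b u =>
    obtain ⟨Γ', h₁, h₂⟩ := ht.anti_subst
    obtain ⟨D, h₃, h₄, rfl⟩ := h₂.of_inst
    -- This is the extra premise; it is the only information about `u` when `D` is empty.
    obtain ⟨Δ₀, τ₀, hu⟩ := hs u (.app_right (.refl u)) fun h => by
      have := congrArg sizeOf h; simp at this
    exact .app D (h₄ ▸ .lam h₁) hu h₃
  | @app t t' u _ ih =>
    cases ht with
    | app D h₁ h₂ h₃ =>
      refine .app D (ih (fun r hr hne => hs r (.app_left hr) ?_) h₁) h₂ h₃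
      rintro rfl
      have := hr.le
      simp at this; omega

/-- The head is a variable, so it can be given whatever arrow type fits one chosen type of each
argument. -/
theorem Lam.Neutral.exists_typing {t : Lam} (h : Neutral t)
    (hs : ∀ r, SubT r t → r ≠ t → LTypeable r) (σ : Strict) : ∃ Γ, LTyping Γ t σ := by
  induction h generalizing σ with
  | var n => exact ⟨_, .var n σ⟩
  | @app t u _ ih =>
    obtain ⟨Δ, τ, hu⟩ := hs u (.app_right (.refl u)) fun h => by
      have := congrArg sizeOf h; simp at this
    obtain ⟨Γ, ht⟩ := ih (fun r hr _ => hs r (.app_left hr) fun h => by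
      subst h; have := hr.le; simp at this; omega) (Strict.arrow {τ} σ)
    exact ⟨_, .app [(Δ, τ)] (by simpa using ht) hu (by simpa using hu)⟩

/-- Strongly normalising plain lambda terms are typeable. -/
theorem LTypeable.of_acc {t : Lam} (h : Acc (fun a b => Beta b a) t) : LTypeable t := by
  suffices ∀ s, SubT s t → LTypeable s from this t (.refl t)
  -- Lexicographic induction: on reductions of the ambient term `t`, then on the size of its subterm
  -- `s`. A head step of `s` is a step of `t`, so the outer hypothesis types the reduct of `s`, and
  -- the inner one supplies the proper subterms needed to expand back.
  induction h with
  | intro t _ ih =>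
    intro s
    induction hn : sizeOf s using Nat.strong_induction_on generalizing s with
    | _ n ihn =>
    intro hst
    have hs : ∀ r, SubT r s → r ≠ s → LTypeable r := fun r hr hne => by
      refine ihn (sizeOf r) ?_ r rfl (hr.trans hst)
      exact hn ▸ hr.eq_or_lt.resolve_left hne
    obtain ⟨b, rfl⟩ | h | ⟨s', h⟩ := head_cases s
    · obtain ⟨Γ, σ, h⟩ := hs b (.lam (.refl b)) fun h => by
        have := congrArg sizeOf h; simp at this
      exact ⟨_, _, .lam h⟩
    · obtain ⟨Γ, h⟩ := h.exists_typing hs (Strict.atom 0)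
      exact ⟨_, _, h⟩
    · obtain ⟨t', ht, hs'⟩ := hst.lift_beta h.toBeta
      obtain ⟨Γ, σ, h'⟩ := ih t' ht s' hs'
      exact ⟨Γ, σ, h'.head_expand h hs⟩

end ResCtrl

namespace ResCtrl

open Pre TBasis
open Lam (shift upr ups ren subst inst)
open Relation (ReflTransGen TransGen)

/-! ### Interpretation of preterms as plain lambda terms -/

/-- The environment `ρ` under a binder of `x`. -/
def bindEnv (ρ : ℕ → Lam) (x : ℕ) : ℕ → Lam := fun v => if v = x then .var 0 else shift (ρ v)

/-- The environment `ρ` in the scope of a duplication of `z` into `x` and `y`. -/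
def dupEnv (ρ : ℕ → Lam) (z x y : ℕ) : ℕ → Lam := fun v => if v = x ∨ v = y then ρ z else ρ v

/-- The plain lambda term of a preterm whose free variables are interpreted by `ρ`. -/
def interp : (ℕ → Lam) → Pre → Lam
  | ρ, .var x => ρ x
  | ρ, .lam x M => .lam (interp (bindEnv ρ x) M)
  | ρ, .app M N => .app (interp ρ M) (interp ρ N)
  | ρ, .era _ M => interp ρ M
  | ρ, .dup z x y M => interp (dupEnv ρ z x y) M
  | ρ, .sub M x N => interp (Function.update ρ x (interp ρ N)) M

theorem interp_congr {M : Pre} {ρ ρ' : ℕ → Lam} (h : ∀ v ∈ fv M, ρ v = ρ' v) :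
    interp ρ M = interp ρ' M := by
  induction M generalizing ρ ρ' with
  | var x => exact h x (by simp [fv])
  | lam x M ih =>
    simp only [interp]
    rw [ih fun v hv => ?_]
    by_cases hvx : v = x
    · simp [bindEnv, hvx]
    · simp [bindEnv, hvx, h v (by simp [fv, hv, hvx])]
  | app M N ihM ihN =>
    simp only [interp]
    rw [ihM fun v hv => h v (by simp [fv, hv]), ihN fun v hv => h v (by simp [fv, hv])]
  | era x M ih => exact ih fun v hv => h v (by simp [fv, hv])
  | dup z x y M ih =>
    refine ih fun v hv => ?_
    by_cases hvx : v = x ∨ v = y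
    · simp only [dupEnv, if_pos hvx]; exact h z (by simp [fv])
    · simp only [dupEnv, if_neg hvx]; exact h v (by simp [fv, hv]; tauto)
  | sub M x N ihM ihN =>
    simp only [interp]
    rw [ihN fun v hv => h v (by simp [fv, hv])]
    refine ihM fun v hv => ?_
    by_cases hvx : v = x
    · simp [hvx]
    · simp [hvx, h v (by simp [fv, hv, hvx])]

theorem interp_perm (π : Equiv.Perm ℕ) (M : Pre) (ρ : ℕ → Lam) :
    interp ρ (perm π M) = interp (ρ ∘ π) M := by
  induction M generalizing ρ with
  | var x => rfl
  | lam x M ih =>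
    simp only [interp, perm, ih]
    congr 2; ext v; simp [bindEnv]
  | app M N ihM ihN => simp only [interp, perm, ihM, ihN]
  | era x M ih => exact ih ρ
  | dup z x y M ih =>
    simp only [interp, perm, ih]
    congr 1; ext v; simp [dupEnv]
  | sub M x N ihM ihN =>
    simp only [interp, perm, ihM, ihN]
    congr 1; ext v; simp [Function.update_apply]

theorem subst_interp (s : ℕ → Lam) (M : Pre) (ρ : ℕ → Lam) :
    subst s (interp ρ M) = interp (fun v => subst s (ρ v)) M := by
  induction M generalizing ρ s with
  | var x => rfl
  | lam x M ih =>
    simp only [interp, subst, ih]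
    congr 2; ext v
    by_cases hv : v = x
    · simp [bindEnv, hv, subst, ups]
    · simp only [bindEnv, if_neg hv]; exact Lam.subst_ups_shift s (ρ v)
  | app M N ihM ihN => simp only [interp, subst, ihM, ihN]
  | era x M ih => exact ih s ρ
  | dup z x y M ih =>
    simp only [interp, ih]
    congr 1; ext v; simp only [dupEnv]; split_ifs <;> rfl
  | sub M x N ihM ihN =>
    simp only [interp, ihM, ← ihN]
    congr 1; ext v; simp only [Function.update_apply]; split_ifs <;> rfl

/-- Identifies a plain β-contraction with an update of the environment, which is how `interp` reads
the substitution operator. -/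
theorem subst_inst_interp_bind (u : Lam) (M : Pre) (x : ℕ) (ρ : ℕ → Lam) :
    subst (inst u) (interp (bindEnv ρ x) M) = interp (Function.update ρ x u) M := by
  rw [subst_interp]
  congr 1; ext v
  by_cases hv : v = x
  · simp [bindEnv, hv, subst, inst]
  · simp [bindEnv, hv, Lam.subst_inst_shift]

/-! ### From typings of plain lambda terms to typings of terms -/

/-- The total context of a basis. -/
def TBasis.tot (Θ : TBasis) : Ctx := fun v => (Θ v).getD 0

theorem SRel.of_bindEnv {ρ : ℕ → Lam} {x : ℕ} {Γ Δ : Ctx} (h : SRel (bindEnv ρ x) Γ Δ) :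
    Γ x = Δ 0 ∧ SRel ρ (Function.update Γ x 0) Δ.tail := by
  refine SRel.of_binder (f := id) (by simp [bindEnv]) (fun y hy => by simp [bindEnv, hy])
    (fun Γ => Function.update Γ x 0) ?_ ?_ ?_ ?_ h
  · ext1 v; simp [Function.update_apply]
  · intro A B; ext1 v; simp only [Function.update_apply, Pi.add_apply]; split_ifs <;> simp
  · intro A; ext1 v; simp only [Function.update_apply, Pi.single_apply]; split_ifs <;> simp
  · intro y A hy; ext1 v
    simp only [Function.update_apply, Pi.single_apply, id]
    split_ifs <;> simp_all

/-- Both bound names have the value of `z`, so their types are added at `z`. They are masked first,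
since `z` may itself coincide with one of them. -/
theorem SRel.of_dupEnv {ρ : ℕ → Lam} {z x y : ℕ} {Γ Δ : Ctx} (hxy : x ≠ y)
    (h : SRel (dupEnv ρ z x y) Γ Δ) :
    SRel ρ ((fun v => if v = x ∨ v = y then 0 else Γ v) + Pi.single z (Γ x + Γ y)) Δ := by
  induction h with
  | zero => convert SRel.zero using 1; ext1 v; simp
  | @single v σ Δ h =>
    by_cases hv : v = x ∨ v = y
    · rw [dupEnv, if_pos hv] at h
      convert SRel.single h using 1
      ext1 w
      rcases hv with rfl | rfl
      · by_cases hw : w = v <;> simp [Pi.single_apply, hw, hxy.symm]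
      · by_cases hw : w = v <;> simp [Pi.single_apply, hw, hxy]
    · rw [dupEnv, if_neg hv] at h
      convert SRel.single h using 1
      push Not at hv
      ext1 w
      by_cases hw : w = v
      · subst hw; simp [Pi.single_apply, hv, hv.1.symm, hv.2.symm]
      · simp [Pi.single_apply, hw, hv.1.symm, hv.2.symm]
  | add _ _ ih ih' =>
    convert SRel.add ih ih' using 1
    ext1 w
    simp only [Pi.add_apply, Pi.single_apply]
    split_ifs <;> abel

theorem TBasis.tot_join {Γ Δ : TBasis} (h : Disj Γ Δ) : tot (join Γ Δ) = tot Γ + tot Δ := by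
  ext1 v
  rcases h v with h | h
  · simp [tot, join, h]
  · cases hΓ : Γ v <;> simp [tot, join, h, hΓ]

theorem TBasis.tot_single (x : ℕ) (A : Ty) : tot (single x A) = Pi.single x A := by
  ext1 v
  by_cases h : v = x <;> simp [tot, single, h]

/-- The member `top Δ₀` contributes only zeros, so totals ignore the extra premise just as `LTyping`
does. -/
theorem TBasis.tot_interTop {Δ₀ : TBasis} {L : List TBasis} (h : ∀ Δ ∈ L, SameDom Δ₀ Δ) :
    tot (interTop Δ₀ L) = (L.map tot).sum := by
  suffices H : ∀ (L : List TBasis) (Θ : TBasis), (∀ Δ ∈ L, SameDom Δ₀ Δ) → SameDom Δ₀ Θ →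
      tot (L.foldl inter Θ) = tot Θ + (L.map tot).sum by
    rw [interTop, H L _ h fun y => by simp [top]]
    convert zero_add _ using 2
    ext1 v
    cases hv : Δ₀ v <;> simp [tot, top, hv]
  intro L
  induction L with
  | nil => intro Θ _ _; simp
  | cons Δ L ih =>
    intro Θ hL hΘ
    have hΔ := hL Δ (by simp)
    have : SameDom Δ₀ (inter Θ Δ) := fun y => by
      rw [inter, Option.map₂_eq_none_iff, ← hΔ y, ← hΘ y, or_self]
    rw [List.foldl_cons, ih _ (fun Δ h => hL Δ (by simp [h])) this, List.map_cons, List.sum_cons,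
      ← add_assoc]
    congr 1
    ext1 v
    have h₁ := hΔ v
    have h₂ := hΘ v
    cases hv : Θ v <;> cases hw : Δ v <;> simp_all [tot, inter]

theorem Typing.eq_none_iff {Γ : TBasis} {M : Pre} {σ : Strict} (h : Typing Γ M σ) (v : ℕ) :
    Γ v = none ↔ v ∉ fv M := by
  rw [← h.isSome_iff v]; simp

/-- A term is typeable if the plain lambda term that it denotes is. -/
theorem IsTerm.typing_of_interp {M : Pre} (hM : IsTerm M) {ρ : ℕ → Lam} {Γ : Ctx} {σ : Strict}
    (h : LTyping Γ (interp ρ M) σ) : ∃ Θ, Typing Θ M σ ∧ SRel ρ Θ.tot Γ := by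
  induction hM generalizing ρ Γ σ with
  | var x => exact ⟨_, .ax x σ, by rw [tot_single]; exact .single h⟩
  | @lam x M hM hx ih =>
    cases h with
    | lam h =>
      obtain ⟨Θ, h₁, h₂⟩ := ih h
      obtain ⟨h₃, h₄⟩ := h₂.of_bindEnv
      obtain ⟨A, hA⟩ := Option.isSome_iff_exists.1 ((h₁.isSome_iff x).2 hx)
      refine ⟨Function.update Θ x none, ?_, ?_⟩
      · rw [← h₃, show tot Θ x = A by simp [tot, hA]]
        refine .arrI (by simp) ?_
        convert h₁ using 1
        ext1 v
        by_cases hv : v = x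
        · subst hv; simp [join, single, hA]
        · simp [join, single, hv]
      · convert h₄ using 1
        ext1 v
        by_cases hv : v = x
        · subst hv; simp [tot]
        · simp [tot, hv]
  | @app M N hM hN hdis ihM ihN =>
    cases h with
    | @app Γ Δ₀ _ _ _ τ₀ D h₁ h₂ h₃ =>
      obtain ⟨Θ, k₁, hr⟩ := ihM h₁
      obtain ⟨Θ₀, k₂, -⟩ := ihN h₂
      have h₄ : ∀ d : Ctx × Strict, ∃ Δ, d ∈ D → Typing Δ N d.2 ∧ SRel ρ Δ.tot d.1 := fun d => by
        by_cases hd : d ∈ D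
        · obtain ⟨Δ, h⟩ := ihN (h₃ d hd); exact ⟨Δ, fun _ => h⟩
        · exact ⟨fun _ => none, fun h => absurd h hd⟩
      choose f hf using h₄
      -- All these bases type `N`, and any basis typing `N` has `fv N` as its domain.
      have hs : ∀ Δ ∈ D.map f, SameDom Θ₀ Δ := by
        intro Δ hΔ y
        obtain ⟨e, he, rfl⟩ := List.mem_map.1 hΔ
        rw [k₂.eq_none_iff, (hf e he).1.eq_none_iff]
      have hd : Disj Θ Θ₀ := fun y => by
        rw [k₁.eq_none_iff, k₂.eq_none_iff]
        by_cases hy : y ∈ fv M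
        exacts [.inr (hdis y hy), .inl hy]
      refine ⟨join Θ (interTop Θ₀ (D.map f)), ?_, ?_⟩
      · have := Typing.arrE (Γ := Θ) (Δ₀ := Θ₀) (M := M) (N := N) (σ := σ) (τ₀ := τ₀)
          (D.map fun d => (f d, d.2)) (by simpa [Function.comp_def] using k₁) k₂
          (by
            intro d hd
            obtain ⟨e, he, rfl⟩ := List.mem_map.1 hd
            exact (hf e he).1)
          (by
            intro d hd
            obtain ⟨e, he, rfl⟩ := List.mem_map.1 hd
            exact hs _ (List.mem_map_of_mem he)) hd
        simpa [Function.comp_def] using this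
      · rw [tot_join, tot_interTop hs, List.map_map]
        · exact .add hr (SRel.list_sum D _ Prod.fst fun d hd => (hf d hd).2)
        · intro y
          refine (hd y).imp_right fun h => ?_
          have := interTop_isSome hs y
          simpa [h] using this
  | @era x M hM hx ih =>
    obtain ⟨Θ, h₁, h₂⟩ := ih h
    have hΘ : Θ x = none := (h₁.eq_none_iff x).2 hx
    refine ⟨_, .thin hΘ h₁, ?_⟩
    rw [tot_join, tot_single, Pi.single_zero, add_zero]
    · exact h₂
    · intro y
      by_cases hy : y = x
      · exact .inl (hy ▸ hΘ)
      · exact .inr (by simp [single, hy])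
  | @dup z x y M hM hx hy hxy hz ih =>
    obtain ⟨Θ, h₁, h₂⟩ := ih h
    obtain ⟨A, hA⟩ := Option.isSome_iff_exists.1 ((h₁.isSome_iff x).2 hx)
    obtain ⟨B, hB⟩ := Option.isSome_iff_exists.1 ((h₁.isSome_iff y).2 hy)
    -- Both bound names leave the domain before `z` is added, which also covers `z` equal to one of
    -- them.
    let Θ' : TBasis := fun v => if v = x ∨ v = y then none else Θ v
    have hΘz : Θ' z = none := by
      by_cases h : z = x ∨ z = y
      · simp [Θ', h]
      · simp only [Θ', if_neg h]
        refine (h₁.eq_none_iff z).2 fun h' => hz ⟨h', ?_⟩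
        tauto
    refine ⟨join Θ' (single z (A + B)), ?_, ?_⟩
    · refine .cont (by simp [Θ']) (by simp [Θ']) hΘz hxy ?_
      convert h₁ using 1
      ext1 v
      by_cases hvx : v = x
      · subst hvx; simp [join, single, Θ', hA]
      by_cases hvy : v = y
      · subst hvy; simp [join, single, Θ', hB, hxy.symm]
      · simp [join, single, Θ', hvx, hvy]
    · rw [tot_join, tot_single]
      · convert h₂.of_dupEnv hxy using 2
        · ext1 v
          by_cases hv : v = x ∨ v = y <;> simp [tot, Θ', hv]
        · simp [tot, hA, hB]
      · intro v
        by_cases hv : v = z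
        · exact .inl (hv ▸ hΘz)
        · exact .inr (by simp [single, hv])

/-! ### Renaming -/

/-- The number of constructors of a preterm. -/
def Pre.size : Pre → ℕ
  | .var _ => 1
  | .lam _ M => size M + 1
  | .app M N => size M + size N + 1
  | .era _ M => size M + 1
  | .dup _ _ _ M => size M + 1
  | .sub M _ N => size M + size N + 1

/-- A preterm without substitution operators. -/
def Pre.NoSub : Pre → Prop
  | .var _ => True
  | .lam _ M => NoSub M
  | .app M N => NoSub M ∧ NoSub N
  | .era _ M => NoSub M
  | .dup _ _ _ M => NoSub M
  | .sub _ _ _ => False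

theorem fv_perm (π : Equiv.Perm ℕ) (M : Pre) : fv (perm π M) = (fv M).map π := by
  induction M <;> simp_all [fv, perm, List.filter_map, Function.comp_def]

theorem mem_fv_perm (π : Equiv.Perm ℕ) (M : Pre) (v : ℕ) :
    v ∈ fv (perm π M) ↔ π.symm v ∈ fv M := by
  rw [fv_perm, List.mem_map]
  exact ⟨by rintro ⟨a, h, rfl⟩; simpa using h, fun h => ⟨_, h, by simp⟩⟩

@[simp] theorem size_perm (π : Equiv.Perm ℕ) (M : Pre) : size (perm π M) = size M := by
  induction M <;> simp_all [size, perm]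

@[simp] theorem noSub_perm (π : Equiv.Perm ℕ) (M : Pre) : NoSub (perm π M) ↔ NoSub M := by
  induction M <;> simp_all [NoSub, perm]

theorem perm_symm_perm (π : Equiv.Perm ℕ) (M : Pre) : perm π.symm (perm π M) = M := by
  induction M <;> simp_all [perm]

theorem IsTerm.perm {M : Pre} (h : IsTerm M) (π : Equiv.Perm ℕ) : IsTerm (perm π M) := by
  induction h with
  | var x => exact .var _
  | lam _ hx ih => exact .lam ih (by simpa [mem_fv_perm] using hx)
  | app _ _ hd ih ih' => exact .app ih ih' fun x => by simpa [mem_fv_perm] using hd _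
  | era _ hx ih => exact .era ih (by simpa [mem_fv_perm] using hx)
  | dup _ h₁ h₂ h₃ h₄ ih =>
    exact .dup ih (by simpa [mem_fv_perm] using h₁) (by simpa [mem_fv_perm] using h₂)
      (by simpa using h₃) (by simpa [mem_fv_perm] using h₄)

theorem isTerm_perm_iff {π : Equiv.Perm ℕ} {M : Pre} : IsTerm (Pre.perm π M) ↔ IsTerm M :=
  ⟨fun h => by simpa [perm_symm_perm] using h.perm π.symm, fun h => h.perm π⟩

theorem IsTerm.noSub {M : Pre} (h : IsTerm M) : NoSub M := by
  induction h <;> simp_all [NoSub]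

/-- Needed for `fv N` to index an iterated erasure or duplication that is again a term. -/
theorem IsTerm.fv_nodup {M : Pre} (h : IsTerm M) : (fv M).Nodup := by
  induction h with
  | var x => simp [fv]
  | lam _ _ ih => exact ih.filter _
  | app _ _ hd ih ih' => exact ih.append ih' (by simpa [List.Disjoint] using hd)
  | era _ hx ih => exact List.nodup_cons.2 ⟨hx, ih⟩
  | dup _ _ _ _ hx ih =>
    refine List.nodup_cons.2 ⟨fun h => hx ?_, ih.filter _⟩
    simpa using List.mem_filter.1 h

theorem mem_fv_swap {x y v : ℕ} {M : Pre} (hy : y ∉ fv M) :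
    v ∈ fv (perm (Equiv.swap x y) M) ∧ v ≠ y ↔ v ∈ fv M ∧ v ≠ x := by
  rw [mem_fv_perm, Equiv.symm_swap]
  by_cases hvx : v = x
  · subst hvx; simp [hy]
  by_cases hvy : v = y
  · subst hvy; simp [hy]
  · simp [Equiv.swap_apply_of_ne_of_ne hvx hvy, hvx, hvy]

theorem mem_fv_swap_right {x y : ℕ} {M : Pre} :
    y ∈ fv (perm (Equiv.swap x y) M) ↔ x ∈ fv M := by
  rw [mem_fv_perm]; simp

/-- Renaming a bound name is absorbed by moving its value in the environment; this gives all the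
renaming cases of `Alpha.interp_eq`. -/
theorem interp_swap {x y : ℕ} {M : Pre} {ρ ρ' : ℕ → Lam} (hy : y ∉ fv M) (hxy : ρ' y = ρ x)
    (h : ∀ v ∈ fv M, v ≠ x → ρ' v = ρ v) :
    interp ρ' (perm (Equiv.swap x y) M) = interp ρ M := by
  rw [interp_perm]
  refine interp_congr fun v hv => ?_
  by_cases hvx : v = x
  · subst hvx; simpa using hxy
  · have hvy : v ≠ y := fun e => hy (e ▸ hv)
    simpa [Equiv.swap_apply_of_ne_of_ne hvx hvy] using h v hv hvx

/-! ### Invariants of α-equivalence and choice of bound names -/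

namespace Alpha

theorem mem_fv {M N : Pre} (h : Alpha M N) (v : ℕ) : v ∈ fv M ↔ v ∈ fv N := by
  induction h with
  | lam_rename hy => simpa [fv] using (mem_fv_swap hy).symm
  | @dup_rename_left x x₁ x₂ y M _ _ hy =>
    have := mem_fv_swap (x := x₁) (v := v) hy
    simp only [fv, List.mem_cons, List.mem_filter, decide_eq_true_eq]
    tauto
  | @dup_rename_right x x₁ x₂ y M _ _ hy =>
    have := mem_fv_swap (x := x₂) (v := v) hy
    simp only [fv, List.mem_cons, List.mem_filter, decide_eq_true_eq]
    tauto
  | @sub_rename x y M N hy =>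
    have := mem_fv_swap (x := x) (v := v) hy
    simp only [fv, List.mem_append, List.mem_filter, decide_eq_true_eq]
    tauto
  | refl => rfl
  | symm _ ih => exact ih.symm
  | trans _ _ ih ih' => exact ih.trans ih'
  | lam _ ih => simp [fv, ih]
  | app _ _ ih ih' => simp [fv, ih, ih']
  | era _ ih => simp [fv, ih]
  | dup _ ih => simp [fv, ih]
  | sub _ _ ih ih' => simp [fv, ih, ih']

theorem size_eq {M N : Pre} (h : Alpha M N) : size M = size N := by
  induction h <;> simp_all [size]

theorem noSub_iff {M N : Pre} (h : Alpha M N) : NoSub M ↔ NoSub N := by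
  induction h <;> simp_all [NoSub]

theorem interp_eq {M N : Pre} (h : Alpha M N) (ρ : ℕ → Lam) : interp ρ M = interp ρ N := by
  induction h generalizing ρ with
  | @lam_rename x y M hy =>
    simp only [interp]
    rw [interp_swap (ρ := bindEnv ρ x) hy (by simp [bindEnv])]
    intro v hv hvx
    have hvy : v ≠ y := fun e => hy (e ▸ hv)
    simp [bindEnv, hvx, hvy]
  | @dup_rename_left x x₁ x₂ y M _ _ hy =>
    refine (interp_swap hy (by simp [dupEnv]) ?_).symm
    intro v hv hvx
    have hvy : v ≠ y := fun e => hy (e ▸ hv)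
    simp [dupEnv, hvx, hvy]
  | @dup_rename_right x x₁ x₂ y M _ _ hy =>
    refine (interp_swap hy (by simp [dupEnv]) ?_).symm
    intro v hv hvx
    have hvy : v ≠ y := fun e => hy (e ▸ hv)
    simp [dupEnv, hvx, hvy]
  | @sub_rename x y M N hy =>
    refine (interp_swap hy (by simp) ?_).symm
    intro v hv hvx
    have hvy : v ≠ y := fun e => hy (e ▸ hv)
    simp [hvx, hvy]
  | refl => rfl
  | symm _ ih => exact (ih ρ).symm
  | trans _ _ ih ih' => exact (ih ρ).trans (ih' ρ)
  | lam _ ih => simp only [interp, ih]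
  | app _ _ ih ih' => simp only [interp, ih, ih']
  | era _ ih => simp only [interp, ih]
  | dup _ ih => simp only [interp, ih]
  | sub _ _ ih ih' => simp only [interp, ih, ih']

theorem isTerm_lam_congr {x y : ℕ} {M N : Pre} (h : IsTerm M ↔ IsTerm N)
    (hx : x ∈ fv M ↔ y ∈ fv N) : IsTerm (.lam x M) ↔ IsTerm (.lam y N) := by
  constructor <;> rintro (_ | _)
  · exact .lam (h.1 ‹_›) (hx.1 ‹_›)
  · exact .lam (h.2 ‹_›) (hx.2 ‹_›)

theorem isTerm_dup_congr {x x₁ x₂ y₁ y₂ : ℕ} {M N : Pre} (h : IsTerm M ↔ IsTerm N)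
    (h₁ : x₁ ∈ fv M ↔ y₁ ∈ fv N) (h₂ : x₂ ∈ fv M ↔ y₂ ∈ fv N) (hne : x₁ ≠ x₂ ↔ y₁ ≠ y₂)
    (hx : x ∈ fv M ∧ x ≠ x₁ ∧ x ≠ x₂ ↔ x ∈ fv N ∧ x ≠ y₁ ∧ x ≠ y₂) :
    IsTerm (.dup x x₁ x₂ M) ↔ IsTerm (.dup x y₁ y₂ N) := by
  constructor <;> intro H <;> cases H with | dup k k₁ k₂ k₃ k₄ => ?_
  · exact .dup (h.1 k) (h₁.1 k₁) (h₂.1 k₂) (hne.1 k₃) (by rwa [← hx])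
  · exact .dup (h.2 k) (h₁.2 k₁) (h₂.2 k₂) (hne.2 k₃) (by rwa [hx])

theorem isTerm_iff {M N : Pre} (h : Alpha M N) : IsTerm M ↔ IsTerm N := by
  induction h with
  | lam_rename hy => exact isTerm_lam_congr isTerm_perm_iff.symm mem_fv_swap_right.symm
  | @dup_rename_left x x₁ x₂ y M h₁ h₂ hy =>
    refine isTerm_dup_congr isTerm_perm_iff.symm mem_fv_swap_right.symm ?_ (by tauto) ?_
    · have := mem_fv_swap (x := x₁) (v := x₂) hy; tauto
    · have := mem_fv_swap (x := x₁) (v := x) hy; tauto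
  | @dup_rename_right x x₁ x₂ y M h₁ h₂ hy =>
    refine isTerm_dup_congr isTerm_perm_iff.symm ?_ mem_fv_swap_right.symm (by tauto) ?_
    · have := mem_fv_swap (x := x₂) (v := x₁) hy; tauto
    · have := mem_fv_swap (x := x₂) (v := x) hy; tauto
  | sub_rename _ => constructor <;> intro h <;> cases h
  | refl => rfl
  | symm _ ih => exact ih.symm
  | trans _ _ ih ih' => exact ih.trans ih'
  | lam h ih => exact isTerm_lam_congr ih (h.mem_fv _)
  | app h h' ih ih' =>
    constructor <;> intro H <;> cases H with | app k₁ k₂ k₃ => ?_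
    · exact .app (ih.1 k₁) (ih'.1 k₂) fun v => by rw [← h.mem_fv, ← h'.mem_fv]; exact k₃ v
    · exact .app (ih.2 k₁) (ih'.2 k₂) fun v => by rw [h.mem_fv, h'.mem_fv]; exact k₃ v
  | era h ih =>
    constructor <;> intro H <;> cases H with | era k₁ k₂ => ?_
    · exact .era (ih.1 k₁) (by rwa [← h.mem_fv])
    · exact .era (ih.2 k₁) (by rwa [h.mem_fv])
  | dup h ih => exact isTerm_dup_congr ih (h.mem_fv _) (h.mem_fv _) Iff.rfl (by rw [h.mem_fv])
  | sub _ _ _ _ => constructor <;> intro h <;> cases h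

theorem exists_fresh (F : List ℕ) : ∃ y, y ∉ F := by
  obtain ⟨y, hy⟩ := Infinite.exists_notMem_finset F.toFinset
  exact ⟨y, by simpa using hy⟩

/-- The variable bound by an abstraction can be chosen outside a given list. -/
theorem exists_lam (F : List ℕ) (x : ℕ) (M : Pre) :
    ∃ y M', y ∉ F ∧ Alpha (.lam x M) (.lam y M') := by
  obtain ⟨y, hy⟩ := exists_fresh (F ++ fv M)
  simp only [List.mem_append, not_or] at hy
  exact ⟨y, _, hy.1, .lam_rename hy.2⟩

/-- The variables bound by a duplication can be chosen outside a given list. -/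
theorem exists_dup (F : List ℕ) {z x y : ℕ} (hxy : x ≠ y) (M : Pre) :
    ∃ x' y' M', x' ∉ F ∧ y' ∉ F ∧ Alpha (.dup z x y M) (.dup z x' y' M') := by
  obtain ⟨x', hx'⟩ := exists_fresh (y :: F ++ fv M)
  obtain ⟨y', hy'⟩ := exists_fresh (x' :: F ++ fv (perm (Equiv.swap x x') M))
  simp only [List.cons_append, List.mem_cons, List.mem_append, not_or] at hx' hy'
  exact ⟨x', y', _, hx'.2.1, hy'.2.1, .trans (.dup_rename_left hxy hx'.1 hx'.2.2)
    (.dup_rename_right hx'.1 hy'.1 hy'.2.2)⟩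

end Alpha

/-! ### Iterated erasures and duplications -/

@[simp] theorem mem_fv_eras {X : List ℕ} {M : Pre} {v : ℕ} :
    v ∈ fv (eras X M) ↔ v ∈ X ∨ v ∈ fv M := by
  induction X <;> simp_all [eras, fv, or_assoc]

@[simp] theorem interp_eras (X : List ℕ) (M : Pre) (ρ : ℕ → Lam) :
    interp ρ (eras X M) = interp ρ M := by
  induction X <;> simp_all [eras, interp]

@[simp] theorem size_eras (X : List ℕ) (M : Pre) : size (eras X M) = X.length + size M := by
  induction X with
  | nil => simp [eras]
  | cons x X ih => simp [eras, size, ih]; omega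

theorem IsTerm.eras {X : List ℕ} {M : Pre} (hM : IsTerm M) (hX : X.Nodup)
    (h : ∀ x ∈ X, x ∉ fv M) : IsTerm (Pre.eras X M) := by
  induction X with
  | nil => exact hM
  | cons x X ih =>
    rw [List.nodup_cons] at hX
    refine .era (ih hX.2 fun y hy => h y (by simp [hy])) ?_
    simp [hX.1, h]

theorem mem_fv_dups {X : List ℕ} {f g : ℕ → ℕ} {M : Pre} {v : ℕ}
    (h : ∀ a ∈ X, ∀ b ∈ X, f a ≠ b ∧ g a ≠ b) :
    v ∈ fv (dups X (X.map f) (X.map g) M) ↔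
      v ∈ X ∨ v ∈ fv M ∧ v ∉ X.map f ∧ v ∉ X.map g := by
  induction X with
  | nil => simp [dups]
  | cons x X ih =>
    simp only [List.map_cons, dups, fv, List.mem_cons, List.mem_filter, decide_eq_true_eq]
    rw [ih fun a ha b hb => h a (by simp [ha]) b (by simp [hb])]
    have : v ∈ X → v ≠ f x ∧ v ≠ g x := fun hv =>
      ⟨(h x (by simp) v (by simp [hv])).1.symm, (h x (by simp) v (by simp [hv])).2.symm⟩
    tauto

/-- Inside the block, `ρ'` gives both copies of `a` the value of `a`. The copies avoid `X`, so an
outer duplication does not disturb the values that the inner ones duplicate. -/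
theorem interp_dups {X : List ℕ} {f g : ℕ → ℕ} {M : Pre} {ρ ρ' : ℕ → Lam}
    (h : ∀ a ∈ X, ∀ b ∈ X, f a ≠ b ∧ g a ≠ b)
    (h₁ : ∀ v ∈ fv M, v ∉ X.map f → v ∉ X.map g → ρ' v = ρ v)
    (h₂ : ∀ a ∈ X, ρ' (f a) = ρ a ∧ ρ' (g a) = ρ a) :
    interp ρ (dups X (X.map f) (X.map g) M) = interp ρ' M := by
  induction X generalizing ρ with
  | nil => exact interp_congr fun v hv => (h₁ v hv (by simp) (by simp)).symm
  | cons x X ih =>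
    simp only [List.map_cons, dups, interp]
    refine ih (fun a ha b hb => h a (by simp [ha]) b (by simp [hb])) ?_ ?_
    · intro v hv hvf hvg
      by_cases hvx : v = f x ∨ v = g x
      · rw [dupEnv, if_pos hvx]
        rcases hvx with rfl | rfl
        exacts [(h₂ x (by simp)).1, (h₂ x (by simp)).2]
      · rw [dupEnv, if_neg hvx]
        push Not at hvx
        exact h₁ v hv (by simpa using ⟨hvx.1, by simpa using hvf⟩)
          (by simpa using ⟨hvx.2, by simpa using hvg⟩)
    · intro a ha
      have : ¬ (a = f x ∨ a = g x) := by
        have := h x (by simp) a (by simp [ha]); tauto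
      rw [dupEnv, if_neg this]
      exact h₂ a (by simp [ha])

@[simp] theorem size_dups (X : List ℕ) (f g : ℕ → ℕ) (M : Pre) :
    size (dups X (X.map f) (X.map g) M) = X.length + size M := by
  induction X with
  | nil => simp [dups]
  | cons x X ih => simp [dups, size, ih]; omega

theorem IsTerm.dups {X : List ℕ} {f g : ℕ → ℕ} {M : Pre} (hM : IsTerm M) (hX : X.Nodup)
    (h : ∀ a ∈ X, ∀ b ∈ X, f a ≠ b ∧ g a ≠ b) (hf : Function.Injective f)
    (hg : Function.Injective g) (hfg : ∀ a ∈ X, ∀ b ∈ X, f a ≠ g b)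
    (h₁ : ∀ a ∈ X, a ∉ fv M) (h₂ : ∀ a ∈ X, f a ∈ fv M ∧ g a ∈ fv M) :
    IsTerm (Pre.dups X (X.map f) (X.map g) M) := by
  induction X with
  | nil => exact hM
  | cons x X ih =>
    rw [List.nodup_cons] at hX
    have hd : ∀ a ∈ X, ∀ b ∈ X, f a ≠ b ∧ g a ≠ b :=
      fun a ha b hb => h a (by simp [ha]) b (by simp [hb])
    have hx := h₂ x (by simp)
    have hT := ih hX.2 hd (fun a ha b hb => hfg a (by simp [ha]) b (by simp [hb]))
      (fun a ha => h₁ a (by simp [ha])) (fun a ha => h₂ a (by simp [ha]))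
    simp only [List.map_cons, Pre.dups]
    refine .dup hT ?_ ?_ (hfg x (by simp) x (by simp)) ?_
    · rw [mem_fv_dups hd]
      refine .inr ⟨hx.1, by simpa [hf.eq_iff] using hX.1, ?_⟩
      simp only [List.mem_map, not_exists, not_and]
      exact fun b hb => (hfg x (by simp) b (by simp [hb])).symm
    · rw [mem_fv_dups hd]
      refine .inr ⟨hx.2, ?_, by simpa [hg.eq_iff] using hX.1⟩
      simp only [List.mem_map, not_exists, not_and]
      exact fun b hb => hfg b (by simp [hb]) x (by simp)
    · rw [mem_fv_dups hd]
      have := h₁ x (by simp)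
      have := hX.1
      tauto

/-! ### Evaluation of iterated substitutions -/

/-- Root rules act on a substitution operator, and the other rules only change the context or the
bound names. Hence terms are normal forms for evaluation. -/
theorem SubEval.not_noSub {M N : Pre} (h : SubEval M N) : ¬ NoSub M := by
  induction h with
  | alpha h _ _ ih => rwa [h.noSub_iff]
  | ctx_app_left _ ih => exact fun h => ih h.1
  | ctx_app_right _ ih => exact fun h => ih h.2
  | ctx_lam _ ih => exact ih
  | ctx_era _ ih => exact ih
  | ctx_dup _ ih => exact ih
  | _ => exact id

theorem IsTerm.not_subEval {M : Pre} (h : IsTerm M) (N : Pre) : ¬ SubEval M N :=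
  fun h' => h'.not_noSub h.noSub

/-- `M[N₁/x₁]⋯[Nₖ/xₖ]` for `L = [(x₁, N₁), …, (xₖ, Nₖ)]`. -/
def Pre.subs (M : Pre) (L : List (ℕ × Pre)) : Pre := L.foldl (fun M p => .sub M p.1 p.2) M

@[simp] theorem subs_nil (M : Pre) : subs M [] = M := rfl

@[simp] theorem subs_cons (M : Pre) (p : ℕ × Pre) (L : List (ℕ × Pre)) :
    subs M (p :: L) = subs (.sub M p.1 p.2) L := rfl

theorem subs_append (M : Pre) (L L' : List (ℕ × Pre)) : subs M (L ++ L') = subs (subs M L) L' :=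
  List.foldl_append

theorem SubEval.subs {M M' : Pre} (h : SubEval M M') (L : List (ℕ × Pre)) :
    SubEval (subs M L) (subs M' L) := by
  induction L generalizing M M' with
  | nil => exact h
  | cons p L ih => exact ih (.ctx_sub h)

theorem Alpha.subs {M M' : Pre} (h : Alpha M M') (L : List (ℕ × Pre)) :
    Alpha (subs M L) (subs M' L) := by
  induction L generalizing M M' with
  | nil => exact h
  | cons p L ih => exact ih (.sub h (.refl _))

theorem not_noSub_subs {M : Pre} {L : List (ℕ × Pre)} (h : ¬ NoSub M ∨ L ≠ []) :
    ¬ NoSub (subs M L) := by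
  induction L generalizing M with
  | nil => simpa using h
  | cons p L ih => exact ih (.inl id)

theorem mem_fv_subs {M : Pre} {L : List (ℕ × Pre)} {v : ℕ} (h : v ∈ fv (subs M L)) :
    v ∈ fv M ∨ ∃ p ∈ L, v ∈ fv p.2 := by
  induction L generalizing M with
  | nil => exact .inl h
  | cons p L ih =>
    rcases ih h with h | ⟨q, hq, h⟩
    · simp only [fv, List.mem_append, List.mem_filter] at h
      rcases h with h | h
      exacts [.inl h.1, .inr ⟨p, by simp, h⟩]
    · exact .inr ⟨q, by simp [hq], h⟩

/-- Reflexive and transitive evaluation of substitutions. -/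
abbrev SubEvals : Pre → Pre → Prop := ReflTransGen SubEval

namespace SubEvals

theorem lift {f : Pre → Pre} (hf : ∀ {a b}, SubEval a b → SubEval (f a) (f b)) {M N : Pre}
    (h : SubEvals M N) : SubEvals (f M) (f N) :=
  ReflTransGen.lift f (fun _ _ => hf) _ _ h

theorem subs {M M' : Pre} (h : SubEvals M M') (L : List (ℕ × Pre)) :
    SubEvals (subs M L) (subs M' L) :=
  h.lift (f := fun M => Pre.subs M L) fun h => h.subs L

theorem subs_lam {y : ℕ} {L : List (ℕ × Pre)} (hy : ∀ p ∈ L, p.1 ≠ y ∧ y ∉ fv p.2) (M : Pre) :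
    SubEvals (Pre.subs (.lam y M) L) (.lam y (Pre.subs M L)) := by
  induction L generalizing M with
  | nil => exact .refl
  | cons p L ih =>
    have hp := hy p (by simp)
    exact .head (SubEval.subs (.lam hp.1 hp.2) L) (ih (fun q hq => hy q (by simp [hq])) _)

theorem subs_era {y : ℕ} {L : List (ℕ × Pre)} (hy : ∀ p ∈ L, p.1 ≠ y) (M : Pre) :
    SubEvals (Pre.subs (.era y M) L) (.era y (Pre.subs M L)) := by
  induction L generalizing M with
  | nil => exact .refl
  | cons p L ih =>
    exact .head (SubEval.subs (.era_ne (hy p (by simp))) L)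
      (ih (fun q hq => hy q (by simp [hq])) _)

theorem subs_eras {X : List ℕ} {L : List (ℕ × Pre)} (hX : ∀ p ∈ L, p.1 ∉ X) (M : Pre) :
    SubEvals (Pre.subs (eras X M) L) (eras X (Pre.subs M L)) := by
  induction X with
  | nil => exact .refl
  | cons x X ih =>
    refine .trans (subs_era (fun p hp h => hX p hp (by simp [h])) _) ?_
    exact (ih fun p hp h => hX p hp (by simp [h])).lift .ctx_era

theorem subs_dup {y y₁ y₂ : ℕ} {L : List (ℕ × Pre)}
    (hy : ∀ p ∈ L, p.1 ≠ y ∧ p.1 ≠ y₁ ∧ p.1 ≠ y₂ ∧ y₁ ∉ fv p.2 ∧ y₂ ∉ fv p.2) (M : Pre) :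
    SubEvals (Pre.subs (.dup y y₁ y₂ M) L) (.dup y y₁ y₂ (Pre.subs M L)) := by
  induction L generalizing M with
  | nil => exact .refl
  | cons p L ih =>
    obtain ⟨h₁, h₂, h₃, h₄, h₅⟩ := hy p (by simp)
    exact .head (SubEval.subs (.dup_ne h₁ h₂ h₃ h₄ h₅) L)
      (ih (fun q hq => hy q (by simp [hq])) _)

theorem dups {X Y Z : List ℕ} {M M' : Pre} (h : SubEvals M M') :
    SubEvals (dups X Y Z M) (dups X Y Z M') := by
  induction X generalizing Y Z with
  | nil => exact h
  | cons x X ih =>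
    rcases Y with _ | ⟨y, Y⟩
    · exact h
    rcases Z with _ | ⟨z, Z⟩
    · exact h
    exact ih.lift .ctx_dup

theorem subs_dups {X : List ℕ} {f g : ℕ → ℕ} {L : List (ℕ × Pre)}
    (h : ∀ p ∈ L, ∀ x ∈ X, p.1 ≠ x ∧ p.1 ≠ f x ∧ p.1 ≠ g x ∧ f x ∉ fv p.2 ∧ g x ∉ fv p.2)
    (M : Pre) : SubEvals (Pre.subs (Pre.dups X (X.map f) (X.map g) M) L)
      (Pre.dups X (X.map f) (X.map g) (Pre.subs M L)) := by
  induction X with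
  | nil => exact .refl
  | cons x X ih =>
    refine .trans (subs_dup (fun p hp => h p hp x (by simp)) _) ?_
    exact (ih fun p hp x hx => h p hp x (by simp [hx])).lift .ctx_dup

/-- The predicate `q` fixes in advance the side receiving each substitution. Since the variables are
distinct, those still waiting remain free in their side after each push. -/
theorem subs_app {L : List (ℕ × Pre)} (q : ℕ → Bool) (hL : (L.map Prod.fst).Nodup) {M N : Pre}
    (h : ∀ p ∈ L, (q p.1 → p.1 ∈ fv M) ∧ (!q p.1 → p.1 ∈ fv N)) :
    SubEvals (Pre.subs (.app M N) L) (.app (Pre.subs M (L.filter fun p => q p.1))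
      (Pre.subs N (L.filter fun p => !q p.1))) := by
  induction L generalizing M N with
  | nil => exact .refl
  | cons p L ih =>
    rw [List.map_cons, List.nodup_cons] at hL
    have hne : ∀ r ∈ L, r.1 ≠ p.1 := fun r hr e => hL.1 (e ▸ List.mem_map_of_mem hr)
    have hp := h p (by simp)
    by_cases hq : q p.1
    · simp only [List.filter_cons, hq, if_true, Bool.not_true, Bool.false_eq_true, if_false]
      refine .head (SubEval.subs (.app_left (hp.1 hq)) L) (ih hL.2 fun r hr => ?_)
      have hr' := h r (by simp [hr])
      refine ⟨fun h => ?_, hr'.2⟩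
      simp [fv, hr'.1 h, hne r hr]
    · simp only [List.filter_cons, hq, if_false, Bool.not_false, if_true, Bool.false_eq_true]
      refine .head (SubEval.subs (.app_right (hp.2 (by simpa using hq))) L)
        (ih hL.2 fun r hr => ?_)
      have hr' := h r (by simp [hr])
      refine ⟨hr'.1, fun h => ?_⟩
      simp [fv, hr'.2 h, hne r hr]

/-- Evaluation to a term may start from any α-equivalent preterm. -/
theorem of_alpha {M M' P : Pre} (h : Alpha M M') (hM : ¬ NoSub M') (hP : NoSub P)
    (h' : SubEvals M' P) : SubEvals M P := by
  rcases h'.cases_head with rfl | ⟨c, hc, hcP⟩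
  · exact absurd hP hM
  · exact .head (.alpha h hc (.refl c)) hcP

end SubEvals

/-! ### Results of iterated substitutions -/

/-- Conditions under which the substitutions in `L` can be performed simultaneously on `M`. -/
structure SubsOk (M : Pre) (L : List (ℕ × Pre)) : Prop where
  term : ∀ p ∈ L, IsTerm p.2
  mem : ∀ p ∈ L, p.1 ∈ fv M
  nodup : (L.map Prod.fst).Nodup
  notMem : ∀ p ∈ L, ∀ a ∈ fv p.2, a ∉ fv M
  disj : ∀ p ∈ L, ∀ q ∈ L, p.1 ≠ q.1 → ∀ a ∈ fv p.2, a ∉ fv q.2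

/-- `P` is the term that results from the substitutions in `L` performed on `M`. -/
structure SubsRes (M : Pre) (L : List (ℕ × Pre)) (P : Pre) : Prop where
  eval : SubEvals (subs M L) P
  term : IsTerm P
  mem_fv : ∀ v, v ∈ fv P ↔ v ∈ fv M ∧ v ∉ L.map Prod.fst ∨ ∃ p ∈ L, v ∈ fv p.2
  interp_eq : ∀ ρ ρ' : ℕ → Lam, (∀ v ∈ fv M, v ∉ L.map Prod.fst → ρ' v = ρ v) →
    (∀ p ∈ L, ρ' p.1 = interp ρ p.2) → interp ρ P = interp ρ' M
  size_eq : (∀ p ∈ L, size p.2 = 1) → size P = size M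

theorem Lam.ren_eq_subst (ξ : ℕ → ℕ) (t : Lam) : ren ξ t = subst (fun n => .var (ξ n)) t := by
  conv_lhs => rw [← Lam.subst_var t]
  exact Lam.ren_subst ξ _ t

/-- Evaluating a substituted term under a binder that does not capture it is weakening, as the
substitution on plain terms demands. -/
theorem interp_bindEnv_of_notMem {y : ℕ} {N : Pre} (h : y ∉ fv N) (ρ : ℕ → Lam) :
    interp (bindEnv ρ y) N = shift (interp ρ N) := by
  rw [shift, Lam.ren_eq_subst, subst_interp]
  refine interp_congr fun v hv => ?_
  have : v ≠ y := by rintro rfl; exact h hv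
  rw [bindEnv, if_neg this, shift, Lam.ren_eq_subst]

theorem interp_dupEnv_of_notMem {z x y : ℕ} {N : Pre} (hx : x ∉ fv N) (hy : y ∉ fv N)
    (ρ : ℕ → Lam) : interp (dupEnv ρ z x y) N = interp ρ N := by
  refine interp_congr fun v hv => ?_
  rw [dupEnv, if_neg]
  rintro (rfl | rfl)
  exacts [hx hv, hy hv]

theorem Pre.size_pos (M : Pre) : 0 < size M := by
  cases M <;> simp [size]

/-- Size one means a variable. Substituting a variable thus replaces one erasure or duplication by
exactly one, which is why sizes are preserved. -/
theorem length_fv_of_size {N : Pre} (hs : size N = 1) : (fv N).length = 1 := by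
  cases N with
  | var x => rfl
  | lam _ M | era _ M | dup _ _ _ M | app M _ | sub M _ _ =>
    simp only [size] at hs
    have := M.size_pos
    omega

theorem SubsOk.alpha {M M' : Pre} {L : List (ℕ × Pre)} (h : Alpha M M') (hL : SubsOk M L) :
    SubsOk M' L where
  term := hL.term
  mem p hp := (h.mem_fv _).1 (hL.mem p hp)
  nodup := hL.nodup
  notMem p hp a ha ha' := hL.notMem p hp a ha ((h.mem_fv _).2 ha')
  disj := hL.disj

/-! ### Results of substitutions by the outermost constructor -/

namespace SubsRes

/-- Evaluation absorbs α-equivalence only within a step, so at least one substitution must be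
present. -/
theorem alpha {M M' P : Pre} {L : List (ℕ × Pre)} (h : Alpha M M') (hL : L ≠ [])
    (hP : SubsRes M' L P) : SubsRes M L P where
  eval := hP.eval.of_alpha (h.subs L) (not_noSub_subs (.inr hL)) hP.term.noSub
  term := hP.term
  mem_fv v := by rw [hP.mem_fv, h.mem_fv]
  interp_eq ρ ρ' h₁ h₂ := by
    rw [h.interp_eq]
    exact hP.interp_eq ρ ρ' (fun v hv => h₁ v ((h.mem_fv v).2 hv)) h₂
  size_eq hs := by rw [hP.size_eq hs, h.size_eq]

theorem nil {M : Pre} (h : IsTerm M) : SubsRes M [] M where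
  eval := .refl
  term := h
  mem_fv v := by simp
  interp_eq ρ ρ' h₁ _ := interp_congr fun v hv => (h₁ v hv (by simp)).symm
  size_eq _ := rfl

theorem var {x : ℕ} {N : Pre} (h : IsTerm N) : SubsRes (.var x) [(x, N)] N where
  eval := .single .var
  term := h
  mem_fv v := by simp [fv]
  interp_eq ρ ρ' _ h₂ := by simpa [interp] using (h₂ (x, N) (by simp)).symm
  size_eq h := by simpa [size] using h

theorem lam {y : ℕ} {M P : Pre} {L : List (ℕ × Pre)} (h : SubsRes M L P) (hM : y ∈ fv M)
    (hy : ∀ p ∈ L, p.1 ≠ y ∧ y ∉ fv p.2) : SubsRes (.lam y M) L (.lam y P) where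
  eval := (SubEvals.subs_lam hy M).trans (h.eval.lift .ctx_lam)
  term := .lam h.term ((h.mem_fv y).2 (.inl ⟨hM, by
    simp only [List.mem_map, not_exists, not_and]; exact fun p hp => (hy p hp).1⟩))
  mem_fv v := by
    simp only [fv, List.mem_filter, decide_eq_true_eq, h.mem_fv v]
    have : (∃ p ∈ L, v ∈ fv p.2) → v ≠ y := by
      rintro ⟨p, hp, hv⟩ rfl; exact (hy p hp).2 hv
    grind
  interp_eq ρ ρ' h₁ h₂ := by
    simp only [interp]
    rw [h.interp_eq (bindEnv ρ y) (bindEnv ρ' y)]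
    · intro v hv hvL
      by_cases hvy : v = y
      · simp [bindEnv, hvy]
      · simp only [bindEnv, if_neg hvy]
        rw [h₁ v (by simp [fv, hv, hvy]) hvL]
    · intro p hp
      rw [interp_bindEnv_of_notMem (hy p hp).2, bindEnv, if_neg (hy p hp).1, h₂ p hp]
  size_eq hs := by simp only [size, h.size_eq hs]

theorem app {M N P Q : Pre} {L : List (ℕ × Pre)} (hL : SubsOk (.app M N) L)
    (hMN : ∀ x ∈ fv M, x ∉ fv N)
    (hP : SubsRes M (L.filter fun p => p.1 ∈ fv M) P)
    (hQ : SubsRes N (L.filter fun p => !decide (p.1 ∈ fv M)) Q) :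
    SubsRes (.app M N) L (.app P Q) where
  eval := by
    refine .trans (SubEvals.subs_app (fun x => x ∈ fv M) hL.nodup fun p hp => ⟨by simp, ?_⟩) ?_
    · have := hL.mem p hp
      simp only [fv, List.mem_append] at this
      simpa [or_iff_not_imp_left] using this
    · exact .trans (hP.eval.lift (f := fun M => .app M _) .ctx_app_left)
        (hQ.eval.lift .ctx_app_right)
  term := by
    refine .app hP.term hQ.term fun v hv hv' => ?_
    rw [hP.mem_fv] at hv
    rw [hQ.mem_fv] at hv'
    simp only [List.mem_filter] at hv hv'
    rcases hv with hv | ⟨p, hp, hv⟩ <;> rcases hv' with hv' | ⟨q, hq, hv'⟩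
    · exact hMN v hv.1 hv'.1
    · exact hL.notMem q hq.1 v hv' (by simp [fv, hv.1])
    · exact hL.notMem p hp.1 v hv (by simp [fv, hv'.1])
    · refine hL.disj p hp.1 q hq.1 (fun e => ?_) v hv hv'
      rw [e] at hp
      simp_all
  mem_fv v := by
    simp only [fv, List.mem_append, hP.mem_fv, hQ.mem_fv, List.mem_filter, List.mem_map]
    constructor
    · rintro ((⟨h₁, h₂⟩ | ⟨p, hp, hv⟩) | (⟨h₁, h₂⟩ | ⟨p, hp, hv⟩))
      · refine .inl ⟨.inl h₁, ?_⟩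
        rintro ⟨p, hp, rfl⟩
        exact h₂ ⟨p, ⟨hp, by simpa using h₁⟩, rfl⟩
      · exact .inr ⟨p, hp.1, hv⟩
      · refine .inl ⟨.inr h₁, ?_⟩
        rintro ⟨p, hp, rfl⟩
        exact h₂ ⟨p, ⟨hp, by simpa using fun h => hMN _ h h₁⟩, rfl⟩
      · exact .inr ⟨p, hp.1, hv⟩
    · rintro (⟨h₁ | h₁, h₂⟩ | ⟨p, hp, hv⟩)
      · exact .inl (.inl ⟨h₁, fun ⟨p, hp, e⟩ => h₂ ⟨p, hp.1, e⟩⟩)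
      · exact .inr (.inl ⟨h₁, fun ⟨p, hp, e⟩ => h₂ ⟨p, hp.1, e⟩⟩)
      · by_cases h : p.1 ∈ fv M
        · exact .inl (.inr ⟨p, ⟨hp, by simpa using h⟩, hv⟩)
        · exact .inr (.inr ⟨p, ⟨hp, by simpa using h⟩, hv⟩)
  interp_eq ρ ρ' h₁ h₂ := by
    simp only [interp]
    rw [hP.interp_eq ρ ρ' _ fun p hp => h₂ p (List.mem_filter.1 hp).1,
      hQ.interp_eq ρ ρ' _ fun p hp => h₂ p (List.mem_filter.1 hp).1]
    · intro v hv hvL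
      refine h₁ v (by simp [fv, hv]) fun h => hvL ?_
      obtain ⟨p, hp, rfl⟩ := List.mem_map.1 h
      exact List.mem_map.2 ⟨p, List.mem_filter.2 ⟨hp, by simpa using fun h => hMN _ h hv⟩, rfl⟩
    · intro v hv hvL
      refine h₁ v (by simp [fv, hv]) fun h => hvL ?_
      obtain ⟨p, hp, rfl⟩ := List.mem_map.1 h
      exact List.mem_map.2 ⟨p, List.mem_filter.2 ⟨hp, by simpa using hv⟩, rfl⟩
  size_eq hs := by
    simp only [size]
    rw [hP.size_eq fun p hp => hs p (List.mem_filter.1 hp).1,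
      hQ.size_eq fun p hp => hs p (List.mem_filter.1 hp).1]

theorem era {y : ℕ} {M P : Pre} {L : List (ℕ × Pre)} (hL : SubsOk (.era y M) L)
    (h : SubsRes M L P) (hM : y ∉ fv M) (hy : ∀ p ∈ L, p.1 ≠ y) :
    SubsRes (.era y M) L (.era y P) where
  eval := (SubEvals.subs_era hy M).trans (h.eval.lift .ctx_era)
  term := by
    refine .era h.term fun hv => ?_
    rcases (h.mem_fv y).1 hv with hv | ⟨p, hp, hv⟩
    · exact hM hv.1
    · exact hL.notMem p hp y hv (by simp [fv])
  mem_fv v := by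
    have : v = y → v ∉ L.map Prod.fst := by
      rintro rfl h
      obtain ⟨p, hp, e⟩ := List.mem_map.1 h
      exact hy p hp e
    simp only [fv, List.mem_cons, h.mem_fv v]
    tauto
  interp_eq ρ ρ' h₁ h₂ := h.interp_eq ρ ρ' (fun v hv => h₁ v (by simp [fv, hv])) h₂
  size_eq hs := by simp only [size, h.size_eq hs]

/-- The substitutions in `A` pass the erasure of `y`, which then becomes the erasures of `fv N`.
Those in `B` pass these because their variables are free in the original term, which shares none
with `N`. -/
theorem era_eq {y : ℕ} {M N P : Pre} {A B : List (ℕ × Pre)}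
    (hL : SubsOk (.era y M) (A ++ (y, N) :: B)) (h : SubsRes M (A ++ B) P) (hM : y ∉ fv M)
    (hA : ∀ p ∈ A, p.1 ≠ y) (hB : ∀ p ∈ B, p.1 ≠ y) :
    SubsRes (.era y M) (A ++ (y, N) :: B) (eras (fv N) P) where
  eval := by
    rw [subs_append, subs_cons]
    refine .trans ((SubEvals.subs_era hA M).lift (f := fun M => .sub M y N) .ctx_sub |>.subs B) ?_
    refine .head (SubEval.subs .era_eq B) ?_
    refine .trans (SubEvals.subs_eras (fun p hp hv => ?_) _) ?_
    · exact hL.notMem (y, N) (by simp) _ hv (hL.mem p (by simp [hp]))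
    · rw [← subs_append]
      have : ∀ X : List ℕ, ∀ {M M'}, SubEvals M M' → SubEvals (eras X M) (eras X M') := by
        intro X M M' h
        induction X with
        | nil => exact h
        | cons x X ih => exact ih.lift .ctx_era
      exact this _ h.eval
  term := by
    refine h.term.eras (hL.term (y, N) (by simp)).fv_nodup fun v hv hv' => ?_
    rcases (h.mem_fv v).1 hv' with hv' | ⟨p, hp, hv'⟩
    · exact hL.notMem (y, N) (by simp) v hv (by simp [fv, hv'.1])
    · refine hL.disj (y, N) (by simp) p ?_ ?_ v hv hv'
      · simp only [List.mem_append, List.mem_cons] at hp ⊢; tauto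
      · rcases List.mem_append.1 hp with hp | hp
        exacts [(hA p hp).symm, (hB p hp).symm]
  mem_fv v := by
    have : v ∈ fv M → v ≠ y := by rintro h rfl; exact hM h
    simp only [mem_fv_eras, h.mem_fv v, fv, List.map_append, List.map_cons, List.mem_append,
      List.mem_cons, or_and_right, exists_or, exists_eq_left]
    grind
  interp_eq ρ ρ' h₁ h₂ := by
    rw [interp_eras, interp]
    refine h.interp_eq ρ ρ' (fun v hv hv' => h₁ v (by simp [fv, hv]) ?_) fun p hp => h₂ p ?_
    · have : v ≠ y := by rintro rfl; exact hM hv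
      simp only [List.map_append, List.map_cons, List.mem_append, List.mem_cons] at hv' ⊢; tauto
    · simp only [List.mem_append, List.mem_cons] at hp ⊢; tauto
  size_eq hs := by
    rw [size_eras, size, length_fv_of_size (hs (y, N) (by simp)), h.size_eq,
      add_comm]
    intro p hp
    apply hs p
    simp only [List.mem_append, List.mem_cons] at hp ⊢; tauto

theorem dup {y y₁ y₂ : ℕ} {M P : Pre} {L : List (ℕ × Pre)} (hL : SubsOk (.dup y y₁ y₂ M) L)
    (hM : IsTerm (.dup y y₁ y₂ M)) (h : SubsRes M L P)
    (hy : ∀ p ∈ L, p.1 ≠ y ∧ p.1 ≠ y₁ ∧ p.1 ≠ y₂ ∧ y₁ ∉ fv p.2 ∧ y₂ ∉ fv p.2) :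
    SubsRes (.dup y y₁ y₂ M) L (.dup y y₁ y₂ P) where
  eval := (SubEvals.subs_dup hy M).trans (h.eval.lift .ctx_dup)
  term := by
    cases hM with | dup hM k₁ k₂ k₃ k₄ => ?_
    refine .dup h.term ((h.mem_fv _).2 (.inl ⟨k₁, ?_⟩)) ((h.mem_fv _).2 (.inl ⟨k₂, ?_⟩)) k₃ ?_
    · simp only [List.mem_map, not_exists, not_and]; exact fun p hp => (hy p hp).2.1
    · simp only [List.mem_map, not_exists, not_and]; exact fun p hp => (hy p hp).2.2.1
    · rintro ⟨h₁, h₂⟩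
      rcases (h.mem_fv y).1 h₁ with hv | ⟨p, hp, hv⟩
      · exact k₄ ⟨hv.1, h₂⟩
      · exact hL.notMem p hp y hv (by simp [fv])
  mem_fv v := by
    have h₁ : v = y → v ∉ L.map Prod.fst := by
      rintro rfl h
      obtain ⟨p, hp, e⟩ := List.mem_map.1 h
      exact (hy p hp).1 e
    have h₂ : (∃ p ∈ L, v ∈ fv p.2) → v ≠ y₁ ∧ v ≠ y₂ := by
      rintro ⟨p, hp, hv⟩
      constructor <;> rintro rfl
      exacts [(hy p hp).2.2.2.1 hv, (hy p hp).2.2.2.2 hv]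
    simp only [fv, List.mem_cons, List.mem_filter, decide_eq_true_eq, h.mem_fv v]
    grind
  interp_eq ρ ρ' h₁ h₂ := by
    simp only [interp]
    refine h.interp_eq _ _ (fun v hv hvL => ?_) fun p hp => ?_
    · by_cases hvy : v = y₁ ∨ v = y₂
      · simp only [dupEnv, if_pos hvy]
        refine h₁ y (by simp [fv]) fun h => ?_
        obtain ⟨p, hp, e⟩ := List.mem_map.1 h
        exact (hy p hp).1 e
      · simp only [dupEnv, if_neg hvy]
        exact h₁ v (by simp [fv, hv]; tauto) hvL
    · obtain ⟨k₁, k₂, k₃, k₄, k₅⟩ := hy p hp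
      rw [interp_dupEnv_of_notMem k₄ k₅, dupEnv, if_neg (by tauto), h₂ p hp]
  size_eq hs := by simp only [size, h.size_eq hs]

end SubsRes

/-- The involution of `ℕ` that exchanges `[0, b)` with `[b, 2b)`. -/
def blockSwap (b : ℕ) : Equiv.Perm ℕ :=
  Function.Involutive.toPerm (fun a => if a < b then a + b else if a < 2 * b then a - b else a)
    fun a => by dsimp only; split_ifs <;> omega

theorem blockSwap_apply {a b : ℕ} (h : a < b) : blockSwap b a = a + b := if_pos h

/-- There are two renamings of a list of variables to distinct fresh variables. -/
theorem exists_copies (X F : List ℕ) : ∃ π₁ π₂ : Equiv.Perm ℕ, (∀ a ∈ X, π₁ a ∉ F) ∧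
    (∀ a ∈ X, π₂ a ∉ F) ∧ ∀ a ∈ X, ∀ b ∈ X, π₁ a ≠ π₂ b := by
  obtain ⟨B, hB⟩ : ∃ B, ∀ a ∈ X ++ F, a < B := by
    generalize X ++ F = Y
    induction Y with
    | nil => exact ⟨0, by simp⟩
    | cons y Y ih =>
      obtain ⟨B, hB⟩ := ih
      refine ⟨max (y + 1) B, fun a ha => ?_⟩
      rcases List.mem_cons.1 ha with rfl | ha
      · omega
      · have := hB a ha; omega
  have hX : ∀ a ∈ X, a < B := fun a ha => hB a (by simp [ha])
  have hF : ∀ a ∈ F, a < B := fun a ha => hB a (by simp [ha])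
  -- All names lie in `[0, B)`; the two copies are sent to `[B, 2B)` and `[2B, 3B)`.
  refine ⟨blockSwap B, blockSwap (2 * B), fun a ha h => ?_, fun a ha h => ?_,
    fun a ha b hb h => ?_⟩
  · have := hX a ha
    rw [blockSwap_apply this] at h
    have := hF _ h; omega
  · have := hX a ha
    rw [blockSwap_apply (by omega)] at h
    have := hF _ h; omega
  · have := hX a ha
    have := hX b hb
    rw [blockSwap_apply (by omega), blockSwap_apply (by omega)] at h
    omega

/-- The data for the substitution of `N` for the variable `y` of `y <^{y₁}_{y₂} M` between the
substitutions in `A` and `B`: two renamings to fresh variables, outside the list `F`. -/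
structure DupData (y y₁ y₂ : ℕ) (M N : Pre) (A B : List (ℕ × Pre)) (F : List ℕ)
    (π₁ π₂ : Equiv.Perm ℕ) : Prop where
  ok : SubsOk (.dup y y₁ y₂ M) (A ++ (y, N) :: B)
  term : IsTerm (.dup y y₁ y₂ M)
  bound : ∀ p ∈ A ++ (y, N) :: B, p.1 ≠ y₁ ∧ p.1 ≠ y₂ ∧ y₁ ∉ fv p.2 ∧ y₂ ∉ fv p.2
  left : ∀ a ∈ fv N, π₁ a ∉ F
  right : ∀ a ∈ fv N, π₂ a ∉ F
  distinct : ∀ a ∈ fv N, ∀ b ∈ fv N, π₁ a ≠ π₂ b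
  mem₁ : ∀ v ∈ [y, y₁, y₂] ++ fv M ++ fv N, v ∈ F
  mem₂ : ∀ p ∈ A ++ (y, N) :: B, p.1 ∈ F ∧ ∀ v ∈ fv p.2, v ∈ F

namespace DupData

variable {y y₁ y₂ : ℕ} {M N : Pre} {A B : List (ℕ × Pre)} {F : List ℕ} {π₁ π₂ : Equiv.Perm ℕ}

theorem ne (h : DupData y y₁ y₂ M N A B F π₁ π₂) {p : ℕ × Pre} (hp : p ∈ A ++ B) : p.1 ≠ y := by
  have := h.ok.nodup
  rw [List.map_append, List.map_cons, List.nodup_middle, List.nodup_cons] at this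
  rintro e
  rw [← List.map_append] at this
  exact this.1 (List.mem_map.2 ⟨p, hp, e⟩)

theorem mem_of_mem {p : ℕ × Pre} (hp : p ∈ A ++ B) : p ∈ A ++ (y, N) :: B := by
  simp only [List.mem_append, List.mem_cons] at hp ⊢; tauto

theorem mem_self : (y, N) ∈ A ++ (y, N) :: B := by simp

theorem mem_cases {p : ℕ × Pre} (hp : p ∈ A ++ (y₁, perm π₁ N) :: (y₂, perm π₂ N) :: B) :
    p ∈ A ++ B ∨ p = (y₁, perm π₁ N) ∨ p = (y₂, perm π₂ N) := by
  simp only [List.mem_append, List.mem_cons] at hp ⊢; tauto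

theorem mem_fv_of (h : DupData y y₁ y₂ M N A B F π₁ π₂) {p : ℕ × Pre} (hp : p ∈ A ++ B) :
    p.1 ∈ fv M := by
  have h₁ := h.ok.mem p (mem_of_mem hp)
  have h₂ := h.ne hp
  simp only [fv, List.mem_cons, List.mem_filter] at h₁
  tauto

/-- The substitution for `y` splits into two, for `y₁` and `y₂`. The list `F` contains every name in
play, so freshness with respect to `F` keeps the copies compatible with the other substitutions. -/
theorem subsOk (h : DupData y y₁ y₂ M N A B F π₁ π₂) :
    SubsOk M (A ++ (y₁, perm π₁ N) :: (y₂, perm π₂ N) :: B) := by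
  have hN := h.ok.term (y, N) mem_self
  obtain ⟨hy₁, hy₂, hne⟩ : y₁ ∈ fv M ∧ y₂ ∈ fv M ∧ y₁ ≠ y₂ := by
    cases h.term with | dup _ k₁ k₂ k₃ _ => exact ⟨k₁, k₂, k₃⟩
  have hperm : ∀ {π : Equiv.Perm ℕ} {v : ℕ}, (∀ a ∈ fv N, π a ∉ F) → v ∈ fv (perm π N) →
      v ∉ F := by
    intro π v hπ hv
    rw [fv_perm, List.mem_map] at hv
    obtain ⟨a, ha, rfl⟩ := hv
    exact hπ a ha
  have hF : ∀ {v}, v ∈ fv M → v ∈ F := fun hv => h.mem₁ _ (by simp [hv])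
  have hd : ∀ v ∈ fv (perm π₁ N), v ∉ fv (perm π₂ N) := by
    intro v hv hv'
    rw [fv_perm, List.mem_map] at hv hv'
    obtain ⟨a, ha, rfl⟩ := hv
    obtain ⟨b, hb, e⟩ := hv'
    exact h.distinct a ha b hb e.symm
  refine ⟨?_, ?_, ?_, ?_, ?_⟩
  · intro p hp
    rcases mem_cases hp with hp | rfl | rfl
    exacts [h.ok.term p (mem_of_mem hp), hN.perm _, hN.perm _]
  · intro p hp
    rcases mem_cases hp with hp | rfl | rfl
    exacts [h.mem_fv_of hp, hy₁, hy₂]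
  · have hnd := h.ok.nodup
    rw [List.map_append, List.map_cons, List.nodup_middle, List.nodup_cons,
      ← List.map_append] at hnd
    rw [List.map_append, List.map_cons, List.map_cons, List.nodup_middle, List.nodup_cons,
      List.nodup_middle, List.nodup_cons, ← List.map_append]
    have hb : ∀ p ∈ A ++ B, p.1 ≠ y₁ ∧ p.1 ≠ y₂ := fun p hp =>
      ⟨(h.bound p (mem_of_mem hp)).1, (h.bound p (mem_of_mem hp)).2.1⟩
    refine ⟨fun hm => ?_, fun hm => ?_, hnd.2⟩
    · rw [List.mem_append, List.mem_cons] at hm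
      have hm : y₁ = y₂ ∨ y₁ ∈ (A ++ B).map Prod.fst := by
        rw [List.map_append, List.mem_append]; tauto
      rcases hm with hm | hm
      · exact hne hm
      · obtain ⟨p, hp, e⟩ := List.mem_map.1 hm
        exact (hb p hp).1 e
    · obtain ⟨p, hp, e⟩ := List.mem_map.1 hm
      exact (hb p hp).2 e
  · intro p hp v hv hvM
    rcases mem_cases hp with hp | rfl | rfl
    · have hb := h.bound p (mem_of_mem hp)
      refine h.ok.notMem p (mem_of_mem hp) v hv ?_
      simp only [fv, List.mem_cons, List.mem_filter, decide_eq_true_eq]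
      refine .inr ⟨hvM, ?_, ?_⟩ <;> rintro rfl
      exacts [hb.2.2.1 hv, hb.2.2.2 hv]
    · exact hperm h.left hv (hF hvM)
    · exact hperm h.right hv (hF hvM)
  · intro p hp q hq hpq v hv hv'
    have hF' : ∀ p ∈ A ++ B, v ∈ fv p.2 → v ∈ F := fun p hp => (h.mem₂ p (mem_of_mem hp)).2 v
    rcases mem_cases hp with hp | rfl | rfl <;> rcases mem_cases hq with hq | rfl | rfl
    · exact h.ok.disj p (mem_of_mem hp) q (mem_of_mem hq) hpq v hv hv'
    · exact hperm h.left hv' (hF' p hp hv)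
    · exact hperm h.right hv' (hF' p hp hv)
    · exact hperm h.left hv (hF' q hq hv')
    · exact hpq rfl
    · exact hd v hv hv'
    · exact hperm h.right hv (hF' q hq hv')
    · exact hd v hv' hv
    · exact hpq rfl

theorem image_ne (h : DupData y y₁ y₂ M N A B F π₁ π₂) :
    ∀ a ∈ fv N, ∀ b ∈ fv N, π₁ a ≠ b ∧ π₂ a ≠ b := by
  have hF : ∀ b ∈ fv N, b ∈ F := fun b hb => h.mem₁ _ (by simp [hb])
  intro a ha b hb
  constructor <;> rintro rfl
  exacts [h.left a ha (hF _ hb), h.right a ha (hF _ hb)]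

theorem eval (h : DupData y y₁ y₂ M N A B F π₁ π₂) :
    SubEvals (subs (.dup y y₁ y₂ M) (A ++ (y, N) :: B))
      (dups (fv N) ((fv N).map π₁) ((fv N).map π₂)
        (subs M (A ++ (y₁, perm π₁ N) :: (y₂, perm π₂ N) :: B))) := by
  have hA : ∀ {p}, p ∈ A → p ∈ A ++ B := fun hp => by simp [hp]
  have hB : ∀ {p}, p ∈ B → p ∈ A ++ B := fun hp => by simp [hp]
  -- When the duplication rule fires, the substitutions in `A` already sit on the body, so the
  -- copies must also avoid the names these introduce.
  have hfv : ∀ v ∈ [y, y₁, y₂] ++ fv (subs M A) ++ fv N, v ∈ F := by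
    intro v hv
    simp only [List.mem_append] at hv
    rcases hv with (hv | hv) | hv
    · exact h.mem₁ v (by simp only [List.mem_append]; tauto)
    · rcases mem_fv_subs hv with hv | ⟨p, hp, hv⟩
      · exact h.mem₁ v (by simp [hv])
      · exact (h.mem₂ p (mem_of_mem (hA hp))).2 v hv
    · exact h.mem₁ v (by simp [hv])
  rw [subs_append, subs_cons, subs_append, subs_cons, subs_cons]
  refine .trans ((SubEvals.subs_dup (fun p hp => ⟨h.ne (hA hp), ?_⟩) M).lift
    (f := fun M => .sub M y N) .ctx_sub |>.subs B) ?_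
  · exact h.bound p (mem_of_mem (hA hp))
  refine .head (SubEval.subs (.dup_eq π₁ π₂ (fun a ha hv => h.left a ha (hfv _ hv))
    (fun a ha hv => h.right a ha (hfv _ hv)) h.distinct) B) ?_
  rw [fv_perm, fv_perm]
  refine SubEvals.subs_dups (fun p hp x hx => ?_) _
  have hp₂ := h.mem₂ p (mem_of_mem (hB hp))
  refine ⟨?_, fun e => h.left x hx (e ▸ hp₂.1), fun e => h.right x hx (e ▸ hp₂.1),
    fun e => h.left x hx (hp₂.2 _ e), fun e => h.right x hx (hp₂.2 _ e)⟩
  rintro rfl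
  exact h.ok.notMem (y, N) mem_self _ hx (h.ok.mem p (mem_of_mem (hB hp)))

theorem subsRes (h : DupData y y₁ y₂ M N A B F π₁ π₂) {P : Pre}
    (hP : SubsRes M (A ++ (y₁, perm π₁ N) :: (y₂, perm π₂ N) :: B) P) :
    SubsRes (.dup y y₁ y₂ M) (A ++ (y, N) :: B)
      (dups (fv N) ((fv N).map π₁) ((fv N).map π₂) P) := by
  have hN := h.ok.term (y, N) mem_self
  have hF : ∀ {v}, v ∈ fv M → v ∈ F := fun hv => h.mem₁ _ (by simp [hv])
  obtain ⟨hy₁, hy₂, hne⟩ : y₁ ∈ fv M ∧ y₂ ∈ fv M ∧ y₁ ≠ y₂ := by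
    cases h.term with | dup _ k₁ k₂ k₃ _ => exact ⟨k₁, k₂, k₃⟩
  have hfv : ∀ v, v ∈ fv P ↔ (v ∈ fv M ∧ v ≠ y₁ ∧ v ≠ y₂ ∧ v ∉ (A ++ B).map Prod.fst) ∨
      v ∈ (fv N).map π₁ ∨ v ∈ (fv N).map π₂ ∨ ∃ p ∈ A ++ B, v ∈ fv p.2 := by
    intro v
    rw [hP.mem_fv v]
    simp only [List.map_append, List.map_cons, List.mem_append, List.mem_cons, or_and_right,
      exists_or, exists_eq_left, fv_perm]
    grind
  have hdisj : ∀ p ∈ A ++ B, ∀ v ∈ fv N, v ∉ fv p.2 := fun p hp v hv =>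
    h.ok.disj (y, N) mem_self p (mem_of_mem hp) (h.ne hp).symm v hv
  have hbound := h.bound (y, N) mem_self
  have himg : ∀ v ∈ F, v ∉ (fv N).map π₁ ∧ v ∉ (fv N).map π₂ := by
    intro v hv
    constructor <;> rw [List.mem_map] <;> rintro ⟨a, ha, rfl⟩
    exacts [h.left a ha hv, h.right a ha hv]
  have hF' : ∀ p ∈ A ++ B, ∀ v ∈ fv p.2, v ∈ F := fun p hp => (h.mem₂ p (mem_of_mem hp)).2
  refine ⟨h.eval.trans hP.eval.dups, ?_, ?_, ?_, ?_⟩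
  · refine hP.term.dups hN.fv_nodup h.image_ne π₁.injective π₂.injective h.distinct ?_ ?_
    · intro a ha hv
      rcases (hfv a).1 hv with ⟨hv, h₁, h₂, -⟩ | hv | hv | ⟨p, hp, hv⟩
      · exact h.ok.notMem (y, N) mem_self a ha (by simp [fv, hv, h₁, h₂])
      · exact (himg a (h.mem₁ _ (by simp [ha]))).1 hv
      · exact (himg a (h.mem₁ _ (by simp [ha]))).2 hv
      · exact hdisj p hp a ha hv
    · intro a ha
      exact ⟨(hfv _).2 (.inr (.inl (List.mem_map_of_mem ha))),
        (hfv _).2 (.inr (.inr (.inl (List.mem_map_of_mem ha))))⟩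
  · intro v
    rw [mem_fv_dups h.image_ne, hfv v]
    have h₁ := himg v
    have h₂ : v ∈ fv M → v ∈ F := hF
    have h₃ : (∃ p ∈ A ++ B, v ∈ fv p.2) → v ∈ F := by
      rintro ⟨p, hp, hv⟩; exact hF' p hp v hv
    have h₅ : (∃ p ∈ A ++ (y, N) :: B, v ∈ fv p.2) ↔ v ∈ fv N ∨ ∃ p ∈ A ++ B, v ∈ fv p.2 := by
      simp only [List.mem_append, List.mem_cons, or_and_right, exists_or, exists_eq_left]
      grind
    have h₆ : v ∈ (A ++ (y, N) :: B).map Prod.fst ↔ v = y ∨ v ∈ (A ++ B).map Prod.fst := by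
      simp only [List.map_append, List.map_cons, List.mem_append, List.mem_cons]
      exact or_left_comm
    have h₇ : y ∈ fv M → y ≠ y₁ → y ≠ y₂ → False := by
      cases h.term with | dup _ _ _ _ k₄ => exact fun a b c => k₄ ⟨a, b, c⟩
    rw [h₅, h₆]
    simp only [fv, List.mem_cons, List.mem_filter, decide_eq_true_eq]
    constructor
    · rintro (hv | ⟨⟨k₁, k₂, k₃, k₄⟩ | hv | hv | hv, k₅, k₆⟩)
      · exact .inr (.inl hv)
      · refine .inl ⟨.inr ⟨k₁, k₂, k₃⟩, ?_⟩
        rintro (rfl | hv)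
        exacts [h₇ k₁ k₂ k₃, k₄ hv]
      · exact absurd hv k₅
      · exact absurd hv k₆
      · exact .inr (.inr hv)
    · rintro (⟨hv | ⟨k₁, k₂, k₃⟩, k₄⟩ | hv | hv)
      · exact absurd (.inl hv) k₄
      · exact .inr ⟨.inl ⟨k₁, k₂, k₃, fun hv => k₄ (.inr hv)⟩, h₁ (h₂ k₁)⟩
      · exact .inl hv
      · exact .inr ⟨.inr (.inr (.inr hv)), h₁ (h₃ hv)⟩
  · intro ρ ρ' h₁ h₂
    -- The environment below the new duplications: each copied name has the value of its original.
    let ρ₁ : ℕ → Lam := fun v => if v ∈ (fv N).map π₁ then ρ (π₁.symm v) else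
      if v ∈ (fv N).map π₂ then ρ (π₂.symm v) else ρ v
    have hρ : ∀ v, v ∉ (fv N).map π₁ → v ∉ (fv N).map π₂ → ρ₁ v = ρ v := fun v hv hv' => by
      simp only [ρ₁, if_neg hv, if_neg hv']
    have hρ₁ : ∀ a ∈ fv N, ρ₁ (π₁ a) = ρ a := fun a ha => by
      simp only [ρ₁, if_pos (List.mem_map_of_mem ha), Equiv.symm_apply_apply]
    have hρ₂ : ∀ a ∈ fv N, ρ₁ (π₂ a) = ρ a := fun a ha => by
      have : π₂ a ∉ (fv N).map π₁ := by
        rw [List.mem_map]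
        rintro ⟨b, hb, e⟩
        exact h.distinct b hb a ha e
      simp only [ρ₁, if_neg this, if_pos (List.mem_map_of_mem ha), Equiv.symm_apply_apply]
    have hρy : ρ' y = interp ρ N := h₂ (y, N) mem_self
    rw [interp_dups h.image_ne (fun v _ => hρ v) (fun a ha => ⟨hρ₁ a ha, hρ₂ a ha⟩)]
    refine hP.interp_eq ρ₁ (dupEnv ρ' y y₁ y₂) (fun v hv hvL => ?_) fun p hp => ?_
    · simp only [List.map_append, List.map_cons, List.mem_append, List.mem_cons, not_or] at hvL
      have hvy : v ≠ y := by
        rintro rfl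
        cases h.term with | dup _ _ _ _ k₄ => exact k₄ ⟨hv, hvL.2.1, hvL.2.2.1⟩
      rw [dupEnv, if_neg (by tauto), hρ v (himg v (hF hv)).1 (himg v (hF hv)).2]
      refine h₁ v (by simp [fv, hv, hvL]) ?_
      simp only [List.map_append, List.map_cons, List.mem_append, List.mem_cons]
      tauto
    · rcases mem_cases hp with hp | rfl | rfl
      · have hb := h.bound p (mem_of_mem hp)
        rw [dupEnv, if_neg (by tauto), h₂ p (mem_of_mem hp)]
        refine interp_congr fun v hv => ?_
        have := himg v (hF' p hp v hv)
        exact (hρ v this.1 this.2).symm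
      · rw [dupEnv, if_pos (.inl rfl), hρy, interp_perm]
        exact interp_congr fun v hv => (hρ₁ v hv).symm
      · rw [dupEnv, if_pos (.inr rfl), hρy, interp_perm]
        exact interp_congr fun v hv => (hρ₂ v hv).symm
  · intro hs
    have hsN := hs (y, N) mem_self
    rw [size_dups, size, length_fv_of_size hsN, hP.size_eq, add_comm]
    intro p hp
    rcases mem_cases hp with hp | rfl | rfl
    · exact hs p (mem_of_mem hp)
    · simpa using hsN
    · simpa using hsN

end DupData

/-- Iterated substitutions can be evaluated. -/
theorem SubsOk.exists_subsRes {M : Pre} (hM : IsTerm M) {L : List (ℕ × Pre)} (hL : SubsOk M L) :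
    ∃ P, SubsRes M L P := by
  -- Whole lists are treated because the duplication rule creates nested substitutions: the list
  -- grows but the body shrinks. Size replaces structural induction since bodies get α-renamed.
  induction hn : size M using Nat.strong_induction_on generalizing M L with
  | _ n ih =>
  subst hn
  by_cases hL₀ : L = []
  · subst hL₀; exact ⟨M, .nil hM⟩
  obtain ⟨F, hF⟩ : ∃ F : List ℕ, ∀ p ∈ L, p.1 ∈ F ∧ ∀ v ∈ fv p.2, v ∈ F :=
    ⟨L.map Prod.fst ++ L.flatMap fun p => fv p.2, fun p hp =>
      ⟨List.mem_append_left _ (List.mem_map_of_mem hp), fun v hv =>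
        List.mem_append_right _ (List.mem_flatMap.2 ⟨p, hp, hv⟩)⟩⟩
  cases hM with
  | var x =>
    match L, hL₀ with
    | [(y, N)], _ =>
      have h₁ := hL.mem (y, N) (by simp)
      have : y = x := by simpa [fv] using h₁
      subst this
      exact ⟨N, .var (hL.term (y, N) (by simp))⟩
    | (y, N) :: (z, N') :: L, _ =>
      have h₁ := hL.mem (y, N) (by simp)
      have h₂ := hL.mem (z, N') (by simp)
      have h₃ := hL.nodup
      simp_all [fv]
  | @lam x M hM hx =>
    obtain ⟨y, M', hy, ha⟩ := Alpha.exists_lam F x M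
    have hs : size M' < size (.lam x M) := by rw [ha.size_eq]; simp [size]
    cases ha.isTerm_iff.1 (.lam hM hx) with | lam hM' hy' => ?_
    have hL' := hL.alpha ha
    have hyL : ∀ p ∈ L, p.1 ≠ y ∧ y ∉ fv p.2 := fun p hp =>
      ⟨fun e => hy (e ▸ (hF p hp).1), fun h => hy ((hF p hp).2 _ h)⟩
    obtain ⟨P, hP⟩ := ih _ hs hM' (L := L) ⟨hL'.term, fun p hp => by
        have := hL'.mem p hp
        simp only [fv, List.mem_filter] at this
        exact this.1, hL'.nodup, fun p hp v hv hv' => by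
        refine hL'.notMem p hp v hv ?_
        simp only [fv, List.mem_filter, decide_eq_true_eq]
        exact ⟨hv', fun e => (hyL p hp).2 (e ▸ hv)⟩, hL'.disj⟩ rfl
    exact ⟨_, (hP.lam hy' hyL).alpha ha hL₀⟩
  | @app M N hM hN hd =>
    have hsub : ∀ q : ℕ × Pre → Bool, ∀ p ∈ L.filter q, p ∈ L := fun q p hp =>
      (List.mem_filter.1 hp).1
    obtain ⟨P, hP⟩ := ih (size M) (by simp only [size]; omega) hM
      (L := L.filter fun p => p.1 ∈ fv M) ⟨fun p hp => hL.term p (hsub _ p hp),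
        fun p hp => by simpa using (List.mem_filter.1 hp).2,
        hL.nodup.sublist (List.filter_sublist.map _),
        fun p hp v hv hv' => hL.notMem p (hsub _ p hp) v hv (by simp [fv, hv']),
        fun p hp q hq => hL.disj p (hsub _ p hp) q (hsub _ q hq)⟩ rfl
    obtain ⟨Q, hQ⟩ := ih (size N) (by simp only [size]; omega) hN
      (L := L.filter fun p => !decide (p.1 ∈ fv M)) ⟨fun p hp => hL.term p (hsub _ p hp),
        fun p hp => by
          have h₁ := hL.mem p (hsub _ p hp)
          have h₂ := (List.mem_filter.1 hp).2
          simp only [fv, List.mem_append] at h₁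
          simp only [Bool.not_eq_true', decide_eq_false_iff_not] at h₂
          tauto,
        hL.nodup.sublist (List.filter_sublist.map _),
        fun p hp v hv hv' => hL.notMem p (hsub _ p hp) v hv (by simp [fv, hv']),
        fun p hp q hq => hL.disj p (hsub _ p hp) q (hsub _ q hq)⟩ rfl
    exact ⟨_, .app hL hd hP hQ⟩
  | @era y M hM hy =>
    have hs : size M < size (.era y M) := by simp [size]
    have hmem : ∀ p ∈ L, p.1 ≠ y → p.1 ∈ fv M := fun p hp hne => by
      have := hL.mem p hp
      simp only [fv, List.mem_cons] at this
      tauto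
    by_cases hyL : y ∈ L.map Prod.fst
    · obtain ⟨⟨z, N⟩, hp, rfl⟩ := List.mem_map.1 hyL
      obtain ⟨A, B, rfl⟩ := List.append_of_mem hp
      have hnd := hL.nodup
      rw [List.map_append, List.map_cons, List.nodup_middle, List.nodup_cons,
        ← List.map_append] at hnd
      have hne : ∀ p ∈ A ++ B, p.1 ≠ z := fun p hp e =>
        hnd.1 (List.mem_map.2 ⟨p, hp, e⟩)
      have hsub : ∀ p ∈ A ++ B, p ∈ A ++ (z, N) :: B := fun p hp => by
        simp only [List.mem_append, List.mem_cons] at hp ⊢; tauto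
      obtain ⟨P, hP⟩ := ih _ hs hM (L := A ++ B) ⟨fun p hp => hL.term p (hsub p hp),
        fun p hp => hmem p (hsub p hp) (hne p hp), hnd.2,
        fun p hp v hv hv' => hL.notMem p (hsub p hp) v hv (by simp [fv, hv']),
        fun p hp q hq => hL.disj p (hsub p hp) q (hsub q hq)⟩ rfl
      exact ⟨_, hP.era_eq hL hy (fun p hp => hne p (by simp [hp]))
        fun p hp => hne p (by simp [hp])⟩
    · have hne : ∀ p ∈ L, p.1 ≠ y := fun p hp e => hyL (e ▸ List.mem_map_of_mem hp)
      obtain ⟨P, hP⟩ := ih _ hs hM (L := L) ⟨hL.term, fun p hp => hmem p hp (hne p hp),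
        hL.nodup, fun p hp v hv hv' => hL.notMem p hp v hv (by simp [fv, hv']), hL.disj⟩ rfl
      exact ⟨_, .era hL hP hy hne⟩
  | @dup y x₁ x₂ M hM h₁ h₂ hne hy =>
    obtain ⟨y₁, y₂, M', hy₁, hy₂, ha⟩ := Alpha.exists_dup F (z := y) hne M
    have hs : size M' < size (.dup y x₁ x₂ M) := by rw [ha.size_eq]; simp [size]
    have hT := ha.isTerm_iff.1 (.dup hM h₁ h₂ hne hy)
    have hM' : IsTerm M' := by cases hT; assumption
    have hL' := hL.alpha ha
    have hb : ∀ p ∈ L, p.1 ≠ y₁ ∧ p.1 ≠ y₂ ∧ y₁ ∉ fv p.2 ∧ y₂ ∉ fv p.2 := fun p hp =>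
      ⟨fun e => hy₁ (e ▸ (hF p hp).1), fun e => hy₂ (e ▸ (hF p hp).1),
        fun h => hy₁ ((hF p hp).2 _ h), fun h => hy₂ ((hF p hp).2 _ h)⟩
    by_cases hyL : y ∈ L.map Prod.fst
    · obtain ⟨⟨z, N⟩, hp, rfl⟩ := List.mem_map.1 hyL
      obtain ⟨A, B, rfl⟩ := List.append_of_mem hp
      obtain ⟨π₁, π₂, hπ₁, hπ₂, hπ⟩ :=
        exists_copies (fv N) (F ++ ([z, y₁, y₂] ++ fv M' ++ fv N))
      have hD : DupData z y₁ y₂ M' N A B (F ++ ([z, y₁, y₂] ++ fv M' ++ fv N)) π₁ π₂ :=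
        ⟨hL', hT, hb, hπ₁, hπ₂, hπ, fun v hv => List.mem_append_right _ hv, fun p hp =>
          ⟨List.mem_append_left _ (hF p hp).1, fun v hv => List.mem_append_left _ ((hF p hp).2 v hv)⟩⟩
      obtain ⟨P, hP⟩ := ih _ hs hM' hD.subsOk rfl
      exact ⟨_, (hD.subsRes hP).alpha ha hL₀⟩
    · have hne : ∀ p ∈ L, p.1 ≠ y := fun p hp e => hyL (e ▸ List.mem_map_of_mem hp)
      obtain ⟨P, hP⟩ := ih _ hs hM' (L := L) ⟨hL'.term, fun p hp => by
          have h₁ := hL'.mem p hp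
          have h₂ := hne p hp
          simp only [fv, List.mem_cons, List.mem_filter] at h₁
          tauto, hL'.nodup, fun p hp v hv hv' => by
          refine hL'.notMem p hp v hv ?_
          simp only [fv, List.mem_cons, List.mem_filter, decide_eq_true_eq]
          refine .inr ⟨hv', ?_, ?_⟩ <;> rintro rfl
          exacts [(hb p hp).2.2.1 hv, (hb p hp).2.2.2 hv], hL'.disj⟩ rfl
      exact ⟨_, (SubsRes.dup hL' hT hP fun p hp => ⟨hne p hp, hb p hp⟩).alpha ha hL₀⟩

/-- Substitution is defined on terms. -/
theorem IsTerm.exists_isSubst {M N : Pre} {x : ℕ} (hM : IsTerm M) (hN : IsTerm N)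
    (hx : x ∈ fv M) (hd : ∀ v ∈ fv N, v ∉ fv M) :
    ∃ P, IsSubst M x N P ∧ IsTerm P ∧ (∀ v, v ∈ fv P ↔ v ∈ fv M ∧ v ≠ x ∨ v ∈ fv N) ∧
      (∀ ρ, interp ρ P = interp (Function.update ρ x (interp ρ N)) M) ∧
      (size N = 1 → size P = size M) := by
  obtain ⟨P, hP⟩ := SubsOk.exists_subsRes hM (L := [(x, N)]) ⟨by simpa using hN,
    by simpa using hx, by simp, by simpa using hd, by simp⟩
  refine ⟨P, ⟨hP.eval, hP.term.not_subEval⟩, hP.term, fun v => by simpa using hP.mem_fv v,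
    fun ρ => hP.interp_eq ρ _ (fun v _ hv => ?_) (by simp), fun h => hP.size_eq (by simpa using h)⟩
  simp only [List.map_cons, List.map_nil, List.mem_singleton] at hv
  simp [hv]

/-! ### Lifting β-reductions -/

/-- Reduction steps to terms with the same free variables. -/
structure Adm (M N : Pre) : Prop where
  term : IsTerm N
  step : Step M N
  mem_fv : ∀ v, v ∈ fv N ↔ v ∈ fv M

/-- Reduction steps that do not change the plain lambda term nor increase the size. -/
structure Silent (M N : Pre) : Prop extends Adm M N where
  interp_eq : ∀ ρ, interp ρ N = interp ρ M
  size_le : size N ≤ size M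

namespace Adm

theorem alpha {M M' N : Pre} (h : Alpha M M') (h' : Adm M' N) : Adm M N :=
  ⟨h'.term, .equiv (.alpha h) h'.step (.refl _), fun v => by rw [h'.mem_fv, h.mem_fv]⟩

theorem lam {x : ℕ} {M N : Pre} (hM : IsTerm (.lam x M)) (h : Adm M N) :
    Adm (.lam x M) (.lam x N) := by
  cases hM with
  | lam _ hx => exact ⟨.lam h.term ((h.mem_fv x).2 hx), .ctx_lam h.step,
      fun v => by simp [fv, h.mem_fv]⟩

theorem app_left {M N P : Pre} (hM : IsTerm (.app M P)) (h : Adm M N) :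
    Adm (.app M P) (.app N P) := by
  cases hM with
  | app _ hP hd => exact ⟨.app h.term hP fun v hv => hd v ((h.mem_fv v).1 hv),
      .ctx_app_left h.step, fun v => by simp [fv, h.mem_fv]⟩

theorem app_right {M N P : Pre} (hM : IsTerm (.app P M)) (h : Adm M N) :
    Adm (.app P M) (.app P N) := by
  cases hM with
  | app hP _ hd => exact ⟨.app hP h.term fun v hv hv' => hd v hv ((h.mem_fv v).1 hv'),
      .ctx_app_right h.step, fun v => by simp [fv, h.mem_fv]⟩

theorem era {x : ℕ} {M N : Pre} (hM : IsTerm (.era x M)) (h : Adm M N) :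
    Adm (.era x M) (.era x N) := by
  cases hM with
  | era _ hx => exact ⟨.era h.term fun hv => hx ((h.mem_fv x).1 hv), .ctx_era h.step,
      fun v => by simp [fv, h.mem_fv]⟩

theorem dup {z x y : ℕ} {M N : Pre} (hM : IsTerm (.dup z x y M)) (h : Adm M N) :
    Adm (.dup z x y M) (.dup z x y N) := by
  cases hM with
  | dup _ hx hy hxy hz =>
    exact ⟨.dup h.term ((h.mem_fv x).2 hx) ((h.mem_fv y).2 hy) hxy (by rwa [h.mem_fv]),
      .ctx_dup h.step, fun v => by simp [fv, h.mem_fv]⟩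

theorem transGen_lift {f : Pre → Pre}
    (hf : ∀ {M N}, IsTerm (f M) → Adm M N → Adm (f M) (f N)) {M N : Pre} (hM : IsTerm (f M))
    (h : TransGen Adm M N) : TransGen Adm (f M) (f N) := by
  induction h with
  | single h => exact .single (hf hM h)
  | tail _ h ih =>
    refine .tail ih (hf ?_ h)
    obtain ⟨c, -, hc⟩ := TransGen.tail'_iff.1 ih
    exact hc.term

/-- Contracting a β-redex. -/
theorem exists_beta {x : ℕ} {M N : Pre} (h : IsTerm (.app (.lam x M) N)) :
    ∃ P, Adm (.app (.lam x M) N) P ∧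
      ∀ ρ, interp ρ P = subst (inst (interp ρ N)) (interp (bindEnv ρ x) M) := by
  -- With the bound name outside `fv N`, the argument shares no free variable at all with the body,
  -- as `IsTerm.exists_isSubst` requires.
  obtain ⟨y, M', hy, ha⟩ := Alpha.exists_lam (fv N) x M
  have ha' := Alpha.app ha (.refl N)
  cases h with | app h₁ hN hd => ?_
  cases ha.isTerm_iff.1 h₁ with | lam hM' hyM => ?_
  have hd' : ∀ v ∈ fv N, v ∉ fv M' := fun v hv hv' => by
    refine hd v ((ha.mem_fv v).2 ?_) hv
    simp only [fv, List.mem_filter, decide_eq_true_eq]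
    exact ⟨hv', fun e => hy (e ▸ hv)⟩
  obtain ⟨P, h₁, h₂, h₃, h₄, -⟩ := hM'.exists_isSubst hN hyM hd'
  refine ⟨P, .alpha ha' ⟨h₂, .beta h₁, fun v => ?_⟩, fun ρ => ?_⟩
  · rw [h₃]; simp [fv]
  · have := ha.interp_eq ρ
    simp only [interp, Lam.lam.injEq] at this
    rw [h₄, this, subst_inst_interp_bind]

end Adm

/-! ### Silent steps moving duplications inwards and erasures outwards -/

namespace Silent

theorem alpha {M M' N : Pre} (h : Alpha M M') (h' : Silent M' N) : Silent M N :=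
  ⟨h'.toAdm.alpha h, fun ρ => by rw [h'.interp_eq, h.interp_eq], h.size_eq ▸ h'.size_le⟩

theorem app_left {M N P : Pre} (hM : IsTerm (.app M P)) (h : Silent M N) :
    Silent (.app M P) (.app N P) :=
  ⟨h.toAdm.app_left hM, fun ρ => by simp only [interp, h.interp_eq], by
    simp only [size]; have := h.size_le; omega⟩

theorem era {x : ℕ} {M N : Pre} (hM : IsTerm (.era x M)) (h : Silent M N) :
    Silent (.era x M) (.era x N) :=
  ⟨h.toAdm.era hM, fun ρ => by simp only [interp, h.interp_eq], by
    simp only [size]; have := h.size_le; omega⟩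

theorem dup {z x y : ℕ} {M N : Pre} (hM : IsTerm (.dup z x y M)) (h : Silent M N) :
    Silent (.dup z x y M) (.dup z x y N) :=
  ⟨h.toAdm.dup hM, fun ρ => by simp only [interp, h.interp_eq], by
    simp only [size]; have := h.size_le; omega⟩

theorem app_era {x : ℕ} {M N : Pre} (h : IsTerm (.app (.era x M) N)) :
    Silent (.app (.era x M) N) (.era x (.app M N)) := by
  cases h with | app h hN hd => ?_
  cases h with | era hM hx => ?_
  refine ⟨⟨.era (.app hM hN fun v hv => hd v (by simp [fv, hv])) ?_, .omega2, fun v => ?_⟩,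
    fun ρ => rfl, by simp only [size]; omega⟩
  · simpa [fv, hx] using hd x (by simp [fv])
  · simp [fv]

/-- The abstraction is first renamed away from `z`, `x`, `y`, so that the duplication can enter it
without capture. -/
theorem exists_dup_lam {z x y u : ℕ} {M : Pre} (h : IsTerm (.dup z x y (.lam u M))) :
    ∃ w N, Silent (.dup z x y (.lam u M)) (.lam w N) := by
  obtain ⟨w, M', hw, ha⟩ := Alpha.exists_lam [z, x, y] u M
  have ha' := Alpha.dup (x := z) (x₁ := x) (x₂ := y) ha
  have h' := ha'.isTerm_iff.1 h
  simp only [List.mem_cons, List.not_mem_nil, or_false, not_or] at hw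
  obtain ⟨h₁, h₂, h₃⟩ := hw
  cases h' with | dup h hx hy hxy hz => ?_
  cases h with | lam hM hwM => ?_
  simp only [fv, List.mem_filter, decide_eq_true_eq] at hx hy hz
  refine ⟨w, .dup z x y M', .alpha ha' ⟨⟨.lam (.dup hM hx.1 hy.1 hxy ?_) ?_, .gamma1 h₁ h₂ h₃,
    fun v => ?_⟩, fun ρ => ?_, le_rfl⟩⟩
  · rintro ⟨k₁, k₂⟩
    exact hz ⟨⟨k₁, Ne.symm h₁⟩, k₂⟩
  · simp [fv, hwM, h₂, h₃]
  · have : v = z → v ≠ w := by rintro rfl; exact Ne.symm h₁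
    simp only [fv, List.mem_filter, List.mem_cons, decide_eq_true_eq]
    grind
  · simp only [interp]
    congr 2
    ext v
    simp only [bindEnv, dupEnv]
    by_cases hv : v = w
    · subst hv; simp [h₂, h₃]
    · by_cases hv' : v = x ∨ v = y
      · simp [hv, hv', Ne.symm h₁]
      · simp [hv, hv']

theorem dup_era {z x y a : ℕ} {M : Pre} (h : IsTerm (.dup z x y (.era a M))) (hx : a ≠ x)
    (hy : a ≠ y) : Silent (.dup z x y (.era a M)) (.era a (.dup z x y M)) := by
  cases h with | dup h h₁ h₂ hxy hz => ?_
  cases h with | era hM ha => ?_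
  simp only [fv, List.mem_cons] at h₁ h₂ hz
  refine ⟨⟨.era (.dup hM (h₁.resolve_left hx.symm) (h₂.resolve_left hy.symm) hxy ?_) ?_,
    .gammaOmega1 hx hy, fun v => ?_⟩, fun ρ => rfl, le_rfl⟩
  · rintro ⟨k₁, k₂⟩; exact hz ⟨.inr k₁, k₂⟩
  · simp only [fv, List.mem_cons, List.mem_filter, not_or, not_and]
    refine ⟨?_, fun h => absurd h ha⟩
    rintro rfl
    exact hz ⟨.inl rfl, hx, hy⟩
  · simp only [fv, List.mem_cons, List.mem_filter, decide_eq_true_eq]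
    have : v = a → v ≠ x ∧ v ≠ y := by rintro rfl; exact ⟨hx, hy⟩
    grind

/-- A duplication with one erased copy is only a renaming of the other to `z`. As `z` may equal `y`,
that copy first gets a fresh name `w`. Substituting a variable preserves size, so the duplication
and the erasure are both saved. -/
theorem exists_dup_era_left {z x y : ℕ} {M : Pre} (h : IsTerm (.dup z x y (.era x M))) :
    ∃ P, Silent (.dup z x y (.era x M)) P ∧ size P < size (.dup z x y (.era x M)) := by
  cases h with | dup h h₁ h₂ hxy hz => ?_
  cases h with | era hM hx => ?_
  obtain ⟨w, hw⟩ := Alpha.exists_fresh (z :: x :: fv (.era x M))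
  simp only [List.mem_cons, not_or] at hw
  obtain ⟨hwz, hwx, hwM⟩ := hw
  have ha : Alpha (.dup z x y (.era x M)) (.dup z x w (.era x (perm (Equiv.swap y w) M))) := by
    have := Alpha.dup_rename_right (x := z) hxy hwx hwM
    rwa [Pre.perm, Equiv.swap_apply_of_ne_of_ne hxy (Ne.symm hwx)] at this
  generalize perm (Equiv.swap y w) M = M' at ha
  cases ha.isTerm_iff.1 (.dup (.era hM hx) h₁ h₂ hxy hz) with | dup h h₁' h₂' hxw hz' => ?_
  cases h with | era hM' hx' => ?_
  simp only [fv, List.mem_cons] at h₂' hz'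
  have hz'' : z ∉ fv M' := fun k =>
    hz' ⟨.inr k, fun e => hx' (e ▸ k), Ne.symm hwz⟩
  obtain ⟨P, k₁, k₂, k₃, k₄, k₅⟩ := hM'.exists_isSubst (.var z)
    (h₂'.resolve_left hwx) (by simpa [fv] using hz'')
  have hs : size P = size M' := k₅ rfl
  refine ⟨P, .alpha ha ⟨⟨k₂, .gammaOmega2 k₁, fun v => ?_⟩, fun ρ => ?_, ?_⟩, ?_⟩
  · rw [k₃]
    have : v ∈ fv M' → v ≠ x := by rintro k rfl; exact hx' k
    simp only [fv, List.mem_cons, List.mem_filter, decide_eq_true_eq, List.not_mem_nil, or_false]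
    grind
  · rw [k₄]
    simp only [interp]
    refine interp_congr fun v hv => ?_
    have : v ≠ x := by rintro rfl; exact hx' hv
    by_cases hv : v = w <;> simp [dupEnv, hv, this]
  · simp only [size]; omega
  · rw [ha.size_eq]; simp only [size]; omega

/-- Commutativity of duplication reduces this to the other side. -/
theorem exists_dup_era_right {z x y : ℕ} {M : Pre} (h : IsTerm (.dup z x y (.era y M))) :
    ∃ P, Silent (.dup z x y (.era y M)) P ∧ size P < size (.dup z x y (.era y M)) := by
  have h' : IsTerm (.dup z y x (.era y M)) := by
    cases h with
    | dup h h₁ h₂ hxy hz => exact .dup h h₂ h₁ hxy.symm fun k => hz ⟨k.1, k.2.2, k.2.1⟩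
  obtain ⟨P, hP, hs⟩ := exists_dup_era_left h'
  refine ⟨P, ⟨⟨hP.term, .equiv .e2 hP.step (.refl P), fun v => ?_⟩, fun ρ => ?_, hP.size_le⟩, hs⟩
  · rw [hP.mem_fv]; simp [fv, and_comm]
  · rw [hP.interp_eq]
    simp only [interp]
    congr 1; ext v; simp [dupEnv, or_comm]

/-- The transitive closure of silent steps, with its invariants. -/
theorem trans_inv {M N : Pre} (hM : IsTerm M) (h : ReflTransGen Silent M N) :
    IsTerm N ∧ (∀ ρ, interp ρ N = interp ρ M) ∧ size N ≤ size M := by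
  induction h with
  | refl => exact ⟨hM, fun _ => rfl, le_rfl⟩
  | tail _ h ih => exact ⟨h.term, fun ρ => by rw [h.interp_eq, ih.2.1], h.size_le.trans ih.2.2⟩

theorem trans_lift {f : Pre → Pre}
    (hf : ∀ {M N}, IsTerm (f M) → Silent M N → Silent (f M) (f N)) {M N : Pre} (hM : IsTerm (f M))
    (h : ReflTransGen Silent M N) : ReflTransGen Silent (f M) (f N) := by
  induction h with
  | refl => exact .refl
  | tail _ h ih => exact .tail ih (hf (trans_inv hM ih).1 h)

end Silent

/-- A term that denotes an abstraction reduces to erasures of an abstraction. -/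
theorem IsTerm.exists_eras_lam {M : Pre} (hM : IsTerm M) {ρ : ℕ → Lam}
    (hρ : ∀ v, ∃ n, ρ v = .var n) {b : Lam} (hb : interp ρ M = .lam b) :
    ∃ X x N, ReflTransGen Silent M (Pre.eras X (.lam x N)) := by
  induction hn : size M using Nat.strong_induction_on generalizing M ρ with
  | _ n ih =>
  subst hn
  cases hM with
  -- Environment values are variables, so an abstraction can only come from the term itself.
  | var x => obtain ⟨n, hn⟩ := hρ x; simp [interp, hn] at hb
  | @lam x M _ _ => exact ⟨[], x, M, .refl⟩
  | app _ _ _ => simp [interp] at hb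
  | @era a M hM ha =>
    obtain ⟨X, x, N, h⟩ := ih _ (by simp [size]) hM hρ hb rfl
    exact ⟨a :: X, x, N, Silent.trans_lift Silent.era (.era hM ha) h⟩
  | @dup z x y M hM hx hy hxy hz =>
    have hT : IsTerm (.dup z x y M) := .dup hM hx hy hxy hz
    have hρ' : ∀ v, ∃ n, dupEnv ρ z x y v = .var n := fun v => by
      unfold dupEnv; split_ifs
      exacts [hρ z, hρ v]
    obtain ⟨X, u, N, h⟩ := ih _ (by simp [size]) hM hρ' hb rfl
    have h' := Silent.trans_lift Silent.dup hT h
    obtain ⟨k₁, k₂, k₃⟩ := Silent.trans_inv hT h'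
    rcases X with _ | ⟨a, X⟩
    · obtain ⟨w, N', hs⟩ := Silent.exists_dup_lam k₁
      exact ⟨[], w, N', h'.tail hs⟩
    · simp only [Pre.eras] at h' k₁ k₂ k₃
      -- For the case where the duplication meets an erasure of one of its own copies: the reduct is
      -- strictly smaller, so the induction restarts from it.
      have key : ∀ P, Silent (.dup z x y (.era a (Pre.eras X (.lam u N)))) P →
          size P < size (.dup z x y (.era a (Pre.eras X (.lam u N)))) →
          ∃ X w N, ReflTransGen Silent (.dup z x y M) (Pre.eras X (.lam w N)) := by
        intro P hP hs
        obtain ⟨X', x', N', h''⟩ := ih _ (hs.trans_le k₃) hP.term hρ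
          (by rw [hP.interp_eq, k₂]; exact hb) rfl
        exact ⟨X', x', N', (h'.tail hP).trans h''⟩
      by_cases hax : a = x
      · subst hax
        obtain ⟨P, hP, hs⟩ := Silent.exists_dup_era_left k₁
        exact key P hP hs
      by_cases hay : a = y
      · subst hay
        obtain ⟨P, hP, hs⟩ := Silent.exists_dup_era_right k₁
        exact key P hP hs
      -- The erasure is unrelated to the duplication and moves out of it; the duplication left below
      -- it is smaller by one erasure.
      have hP := Silent.dup_era k₁ hax hay
      cases hP.term with | era hD ha => ?_
      obtain ⟨X', x', N', h''⟩ := ih (size (.dup z x y (Pre.eras X (.lam u N))))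
        (lt_of_lt_of_le (by simp [size]) k₃) hD hρ
        (by have := hP.interp_eq ρ
            rw [k₂] at this
            exact this.trans hb) rfl
      exact ⟨a :: X', x', N',
        (h'.tail hP).trans (Silent.trans_lift Silent.era (.era hD ha) h'')⟩

/-- Every β-reduction of the plain lambda term denoted by a term lifts to that term. -/
theorem IsTerm.exists_lift_beta {M : Pre} (hM : IsTerm M) {ρ : ℕ → Lam}
    (hρ : ∀ v, ∃ n, ρ v = .var n) {t : Lam} (ht : Lam.Beta (interp ρ M) t) :
    ∃ N, TransGen Adm M N ∧ interp ρ N = t := by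
  induction hM generalizing ρ t with
  | var x =>
    obtain ⟨n, hn⟩ := hρ x
    rw [interp, hn] at ht
    cases ht
  | @lam x M hM hx ih =>
    cases ht with
    | lam ht =>
      have hρ' : ∀ v, ∃ n, bindEnv ρ x v = .var n := fun v => by
        by_cases hv : v = x
        · exact ⟨0, by simp [bindEnv, hv]⟩
        · obtain ⟨n, hn⟩ := hρ v
          exact ⟨n + 1, by simp [bindEnv, hv, hn, ren]⟩
      obtain ⟨N, h, rfl⟩ := ih hρ' ht
      exact ⟨_, Adm.transGen_lift Adm.lam (.lam hM hx) h, rfl⟩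
  | @app M N hM hN hd ihM ihN =>
    have hT := IsTerm.app hM hN hd
    rw [interp] at ht
    generalize ha : interp ρ M = a at ht
    cases ht with
    | app_left ht =>
      obtain ⟨M', h, rfl⟩ := ihM hρ (ha ▸ ht)
      exact ⟨_, Adm.transGen_lift (f := fun M => .app M N) Adm.app_left hT h, rfl⟩
    | app_right ht =>
      obtain ⟨N', h, rfl⟩ := ihN hρ ht
      exact ⟨_, Adm.transGen_lift Adm.app_right hT h, by rw [interp, ha]⟩
    | beta b _ =>
      -- Silent steps expose the abstraction up to erasures `X`. These are then pulled out of the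
      -- application one at a time, leaving a genuine redex.
      obtain ⟨X, x, M', h⟩ := hM.exists_eras_lam hρ ha
      have h₁ := Silent.trans_lift (f := fun M => .app M N) Silent.app_left hT h
      have key : ∀ X : List ℕ, IsTerm (.app (Pre.eras X (.lam x M')) N) →
          ∃ P, TransGen Adm (.app (Pre.eras X (.lam x M')) N) P ∧
            ∀ ρ, interp ρ P = subst (inst (interp ρ N)) (interp (bindEnv ρ x) M') := by
        intro X hX
        induction X with
        | nil =>
          obtain ⟨P, hP, hi⟩ := Adm.exists_beta hX
          exact ⟨P, .single hP, hi⟩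
        | cons a X ih =>
          have hs := Silent.app_era hX
          cases hs.term with | era hT' ha' => ?_
          obtain ⟨P, hP, hi⟩ := ih hT'
          exact ⟨.era a P, .head hs.toAdm (Adm.transGen_lift Adm.era (.era hT' ha') hP), hi⟩
      obtain ⟨P, hP, hi⟩ := key X (Silent.trans_inv hT h₁).1
      refine ⟨P, TransGen.trans_right (ReflTransGen.mono (fun _ _ h => h.toAdm) _ _ h₁) hP, ?_⟩
      have := (Silent.trans_inv hM h).2.1 ρ
      rw [ha, interp_eras, interp, Lam.lam.injEq] at this
      rw [hi, this]
  | @era x M hM hx ih =>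
    obtain ⟨N, h, rfl⟩ := ih hρ ht
    exact ⟨_, Adm.transGen_lift Adm.era (.era hM hx) h, rfl⟩
  | @dup z x y M hM hx hy hxy hz ih =>
    have hρ' : ∀ v, ∃ n, dupEnv ρ z x y v = .var n := fun v => by
      unfold dupEnv; split_ifs
      exacts [hρ z, hρ v]
    obtain ⟨N, h, rfl⟩ := ih hρ' ht
    exact ⟨_, Adm.transGen_lift Adm.dup (.dup hM hx hy hxy hz) h, rfl⟩

/-- The plain lambda term denoted by a strongly normalising term is strongly normalising. -/
theorem SN.acc_interp {M : Pre} (h : SN M) (hM : IsTerm M) {ρ : ℕ → Lam}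
    (hρ : ∀ v, ∃ n, ρ v = .var n) : Acc (fun a b => Lam.Beta b a) (interp ρ M) := by
  -- Lifting one β-step may take several steps, so the claim is made for all iterated reducts: the
  -- induction hypothesis for the first step then reaches the end of the sequence.
  suffices ∀ N, ReflTransGen Adm M N → Acc (fun a b => Lam.Beta b a) (interp ρ N) from
    this M .refl
  induction h with
  | @intro M _ ih =>
    intro N hN
    rcases hN.cases_head with rfl | ⟨M', h₁, h₂⟩
    · refine .intro _ fun t ht => ?_
      obtain ⟨N', h, rfl⟩ := hM.exists_lift_beta hρ ht
      obtain ⟨M', h₁, h₂⟩ := TransGen.head'_iff.1 h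
      exact ih M' h₁.term h₁.step h₁.term N' h₂
    · exact ih M' h₁.term h₁.step h₁.term N h₂

end ResCtrl

theorem mainTheorem3 (M : ResCtrl.Pre) (hM : ResCtrl.IsTerm M) (hSN : ResCtrl.SN M) :
    ResCtrl.Typeable M := by
  obtain ⟨Γ, σ, h⟩ :=
    ResCtrl.LTypeable.of_acc (hSN.acc_interp hM (ρ := ResCtrl.Lam.var) fun v => ⟨v, rfl⟩)
  obtain ⟨Θ, hΘ, -⟩ := hM.typing_of_interp h
  exact ⟨Θ, σ, hΘ⟩
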